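/- Let $\Bbbk$ be a field of prime characteristic $p$, let $n>1$ be an integer with $p\mid n-1$, and let $c\in\Bbbk$, $c\neq 0$. Let $S_n$ act on $V=\bigoplus_{i=1}^n\Bbbk y_i$ and on $V^*$ (dual basis $x_1,\dots,x_n$) by permuting the basis vectors, and put $\mathfrak h=\mathrm{Span}\{y_i-y_j\}\subset V$ and $\mathfrak h^*=V^*/(x_1+\dots+x_n)$. Write $\sigma_{ij}\in S_n$ for the transposition of $i$ and $j$. Let $\mathcal H_{0,c}=\mathcal H_{0,c}(S_n,\mathfrak h)$ be the rational Cherednik algebra of type $A_{n-1}$ at $t=0$, that is, the quotient of $\Bbbk S_n\ltimes T(\mathfrak h\oplus\mathfrak h^*)$ by the relations $[x_i,x_j]=0$, $[y_i-y_j,y_l-y_m]=0$, $[y_i-y_j,x_i]=-c\,\sigma_{ij}-c\sum_{l\ne i}\sigma_{il}$ for $i\neq j$, and $[y_i-y_j,x_l]=c\,\sigma_{il}-c\,\sigma_{jl}$ for $l\neq i,j$. It acts on $S\mathfrak h^*=\Bbbk[x_1,\dots,x_n]/(x_1+\dots+x_n)$ (the polynomial representation) with $S_n$ acting naturally, $x\in\mathfrak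 h^*$ acting by multiplication, and $y_i-y_j$ acting by the Dunkl operator $D_{y_i}-D_{y_j}$, where $D_{y_i}=-c\sum_{l\ne i}(x_i-x_l)^{-1}(1-\sigma_{il})$. Let $f\mapsto f(D)$ be the extension of $y\mapsto D_y$ to an algebra homomorphism $S\mathfrak h\to\mathrm{End}(S\mathfrak h^*)$, let $\mathcal B(f,q)$, for $f\in S\mathfrak h$ and $q\in S\mathfrak h^*$, be the constant term of $f(D)q$ (the contravariant form), and let $$\mathcal L_{0,c}=S\mathfrak h^*/\ker\mathcal B,\qquad \ker\mathcal B=\{q\in S\mathfrak h^* : \mathcal B(f,q)=0\ \text{for all } f\in S\mathfrak h\}.$$ Let $\mathcal L_{0,c}[i]$ be the image in $\mathcal L_{0,c}$ of the homogeneous polynomials of degree $i$. Then $\mathcal L_{0,c}$ is an irreducible $\mathcal H_{0,c}$-module, $\mathcal L_{0,c}=\bigoplus_{i\ge0}\mathcal L_{0,c}[i]$, and its Hilbert series is $$h_{\mathcal L_{0,c}}(z)=\sum_{i\ge 0}\dim\mathcal L_{0,c}[i]\,z^i=\left(\frac{1-z^p}{1-z}\right)\left(1+(n-2)z+z^2\right).$$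 In particular, this equals the series $[r]_z!\,[p]_z\,Q_r(n,z)$ conjectured by Etingof and Rains, where $r$ is the residue of $n$ modulo $p$ (here $r=1$), $[m]_z=\frac{1-z^m}{1-z}$, $[r]_z!=[r]_z[r-1]_z\cdots[1]_z$, and $Q_r(n,z)=\binom{n-1}{r-1}z^{r+1}+\sum_{i=0}^{r}\binom{n-r-2+i}{i}z^i$. -/

import Mathlib

noncomputable section

namespace RationalCherednik

open MvPolynomial

section Algebra

variable (k : Type*) [Field k] (n : ℕ)

/-- The reflection representation `𝔥 = Span {y_i - y_j}` inside the permutation representation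
`V = k^n` with basis `y_1, …, y_n`. -/
def hSub : Submodule k (Fin n → k) :=
  Submodule.span k (Set.range fun ij : Fin n × Fin n =>
    (Pi.single ij.1 1 - Pi.single ij.2 1 : Fin n → k))

/-- The vector `y_i - y_j` of `𝔥`. -/
def yDiff (i j : Fin n) : hSub k n :=
  ⟨Pi.single i 1 - Pi.single j 1, Submodule.subset_span ⟨(i, j), rfl⟩⟩

/-- The dual `𝔥^* = V^* / (x_1 + ⋯ + x_n)`. -/
abbrev HDual : Type _ := (Fin n → k) ⧸ Submodule.span k {(fun _ => 1 : Fin n → k)}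

/-- The class of `x_i` in `𝔥^*`. -/
def xBar (i : Fin n) : HDual k n := Submodule.Quotient.mk (Pi.single i 1)

/-- Generators of `k S_n ⋉ T(𝔥 ⊕ 𝔥^*)`. -/
inductive Gen : Type _
  | perm (σ : Equiv.Perm (Fin n)) : Gen
  | y (v : hSub k n) : Gen
  | x (w : HDual k n) : Gen

variable {k n}

/-- The element of the free algebra given by a permutation. -/
abbrev gPerm (σ : Equiv.Perm (Fin n)) : FreeAlgebra k (Gen k n) := FreeAlgebra.ι k (Gen.perm σ)

/-- The element of the free algebra given by a vector of `𝔥`. -/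
abbrev gY (v : hSub k n) : FreeAlgebra k (Gen k n) := FreeAlgebra.ι k (Gen.y v)

/-- The element of the free algebra given by a vector of `𝔥^*`. -/
abbrev gX (w : HDual k n) : FreeAlgebra k (Gen k n) := FreeAlgebra.ι k (Gen.x w)

/-- The relations of the rational Cherednik algebra. The first eight present the algebra
`k S_n ⋉ T(𝔥 ⊕ 𝔥^*)`; the last four are the defining commutation relations. -/
inductive Rel (t c : k) : FreeAlgebra k (Gen k n) → FreeAlgebra k (Gen k n) → Prop
  | y_add (v w : hSub k n) : Rel t c (gY (v + w)) (gY v + gY w)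
  | y_smul (a : k) (v : hSub k n) : Rel t c (gY (a • v)) (a • gY v)
  | x_add (v w : HDual k n) : Rel t c (gX (v + w)) (gX v + gX w)
  | x_smul (a : k) (v : HDual k n) : Rel t c (gX (a • v)) (a • gX v)
  | perm_one : Rel t c (gPerm 1) 1
  | perm_mul (σ τ : Equiv.Perm (Fin n)) : Rel t c (gPerm (σ * τ)) (gPerm σ * gPerm τ)
  | perm_y (σ : Equiv.Perm (Fin n)) (i j : Fin n) :
      Rel t c (gPerm σ * gY (yDiff k n i j)) (gY (yDiff k n (σ i) (σ j)) * gPerm σ)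
  | perm_x (σ : Equiv.Perm (Fin n)) (i : Fin n) :
      Rel t c (gPerm σ * gX (xBar k n i)) (gX (xBar k n (σ i)) * gPerm σ)
  | x_comm (v w : HDual k n) : Rel t c (gX v * gX w) (gX w * gX v)
  | y_comm (v w : hSub k n) : Rel t c (gY v * gY w) (gY w * gY v)
  | cross_self (i j : Fin n) (hij : i ≠ j) :
      Rel t c
        (gY (yDiff k n i j) * gX (xBar k n i) - gX (xBar k n i) * gY (yDiff k n i j))
        (algebraMap k _ t - c • gPerm (Equiv.swap i j)
          - c • ∑ l ∈ Finset.univ.erase i, gPerm (Equiv.swap i l))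
  | cross_other (i j l : Fin n) (hi : l ≠ i) (hj : l ≠ j) :
      Rel t c
        (gY (yDiff k n i j) * gX (xBar k n l) - gX (xBar k n l) * gY (yDiff k n i j))
        (c • gPerm (Equiv.swap i l) - c • gPerm (Equiv.swap j l))

variable (k n)

/-- The rational Cherednik algebra `H_{t,c}(S_n, 𝔥)` of type `A_{n-1}`. -/
abbrev CherednikAlgebra (t c : k) : Type _ := RingQuot (Rel (k := k) (n := n) t c)

end Algebra

section Dunkl

variable {k : Type*} [Field k] {n : ℕ}

theorem dvd_sub_swap (i j : Fin n) (f : MvPolynomial (Fin n) k) :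
    (X i - X j : MvPolynomial (Fin n) k) ∣ f - rename (Equiv.swap i j) f := by
  induction f using MvPolynomial.induction_on with
  | C a => simp
  | add p q hp hq =>
    rw [map_add, add_sub_add_comm]
    exact dvd_add hp hq
  | mul_X p l hp =>
    have h : p * X l - rename (Equiv.swap i j) (p * X l)
        = (p - rename (Equiv.swap i j) p) * X l
          + rename (Equiv.swap i j) p * (X l - X (Equiv.swap i j l)) := by
      rw [map_mul, rename_X]; ring
    rw [h]
    refine dvd_add (hp.mul_right _) (Dvd.dvd.mul_left ?_ _)
    rcases eq_or_ne l i with rfl | hi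
    · simp
    · rcases eq_or_ne l j with rfl | hj
      · rw [Equiv.swap_apply_right]
        exact ⟨-1, by ring⟩
      · simp [Equiv.swap_apply_of_ne_of_ne hi hj]

/-- The quotient `(f - σ_ij f) / (x_i - x_j)` for `i ≠ j` (and `0` for `i = j`). -/
def divDiffFun (i j : Fin n) (f : MvPolynomial (Fin n) k) : MvPolynomial (Fin n) k :=
  if i = j then 0 else Classical.choose (dvd_sub_swap i j f)

theorem divDiffFun_spec (i j : Fin n) (hij : i ≠ j) (f : MvPolynomial (Fin n) k) :
    (X i - X j) * divDiffFun i j f = f - rename (Equiv.swap i j) f := by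
  rw [divDiffFun, if_neg hij]
  exact (Classical.choose_spec (dvd_sub_swap i j f)).symm

theorem X_sub_X_ne_zero (i j : Fin n) (hij : i ≠ j) :
    (X i - X j : MvPolynomial (Fin n) k) ≠ 0 :=
  sub_ne_zero.mpr fun h => hij (X_injective h)

/-- The operator `(x_i - x_j)^{-1} (1 - σ_ij)` on `k[x_1, …, x_n]`, for `i ≠ j`. -/
def divDiff (i j : Fin n) : Module.End k (MvPolynomial (Fin n) k) where
  toFun := divDiffFun i j
  map_add' f g := by
    by_cases hij : i = j
    · simp [divDiffFun, hij]
    · apply mul_left_cancel₀ (X_sub_X_ne_zero (k := k) i j hij)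
      rw [mul_add, divDiffFun_spec i j hij, divDiffFun_spec i j hij, divDiffFun_spec i j hij,
        map_add]
      ring
  map_smul' a f := by
    by_cases hij : i = j
    · simp [divDiffFun, hij]
    · apply mul_left_cancel₀ (X_sub_X_ne_zero (k := k) i j hij)
      rw [RingHom.id_apply, mul_smul_comm, divDiffFun_spec i j hij, divDiffFun_spec i j hij,
        map_smul, smul_sub]

theorem divDiff_spec (i j : Fin n) (hij : i ≠ j) (f : MvPolynomial (Fin n) k) :
    (X i - X j) * divDiff i j f = f - rename (Equiv.swap i j) f :=
  divDiffFun_spec i j hij f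

/-- The Dunkl operator `D_{y_i} = t ∂_i - c ∑_{j ≠ i} (x_i - x_j)^{-1} (1 - σ_ij)` on
`k[x_1, …, x_n]`. -/
def dunklV (t c : k) (i : Fin n) : Module.End k (MvPolynomial (Fin n) k) :=
  t • (pderiv i : Derivation k _ _).toLinearMap - c • ∑ j ∈ Finset.univ.erase i, divDiff i j

theorem dunklV_apply (t c : k) (i : Fin n) (f : MvPolynomial (Fin n) k) :
    dunklV t c i f = t • pderiv i f - c • ∑ j ∈ Finset.univ.erase i, divDiff i j f := by
  simp [dunklV]

theorem divDiff_X_mul (i j : Fin n) (hij : i ≠ j) (l : Fin n) (f : MvPolynomial (Fin n) k) :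
    divDiff i j (X l * f) = X l * divDiff i j f
      + (if l = i then rename (Equiv.swap i j) f else 0)
      - (if l = j then rename (Equiv.swap i j) f else 0) := by
  apply mul_left_cancel₀ (X_sub_X_ne_zero (k := k) i j hij)
  rw [divDiff_spec i j hij, mul_sub, mul_add, mul_left_comm, divDiff_spec i j hij, map_mul,
    rename_X]
  rcases eq_or_ne l i with rfl | hi
  · rw [if_pos rfl, if_neg hij, Equiv.swap_apply_left]; ring
  · rcases eq_or_ne l j with rfl | hj
    · rw [if_neg hi, if_pos rfl, Equiv.swap_apply_right]; ring
    · rw [if_neg hi, if_neg hj, Equiv.swap_apply_of_ne_of_ne hi hj]; ring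

theorem divDiff_rename (σ : Equiv.Perm (Fin n)) (i j : Fin n) (f : MvPolynomial (Fin n) k) :
    divDiff (σ i) (σ j) (rename σ f) = rename σ (divDiff i j f) := by
  by_cases hij : i = j
  · subst hij; simp [divDiff, divDiffFun]
  have hσ : σ i ≠ σ j := fun h => hij (σ.injective h)
  apply mul_left_cancel₀ (X_sub_X_ne_zero (k := k) _ _ hσ)
  have h := congrArg (rename σ) (divDiff_spec i j hij f)
  rw [map_mul, map_sub, rename_X, rename_X] at h
  rw [h, divDiff_spec _ _ hσ, map_sub, rename_rename, rename_rename]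
  congr 3
  funext l
  simp [Equiv.swap_apply_def, apply_ite σ, σ.injective.eq_iff]

theorem pderiv_rename_perm (σ : Equiv.Perm (Fin n)) (i : Fin n) (f : MvPolynomial (Fin n) k) :
    pderiv (σ i) (rename σ f) = rename σ (pderiv i f) :=
  pderiv_rename σ.injective i f

theorem dunklV_rename (t c : k) (σ : Equiv.Perm (Fin n)) (i : Fin n)
    (f : MvPolynomial (Fin n) k) :
    dunklV t c (σ i) (rename σ f) = rename σ (dunklV t c i f) := by
  rw [dunklV_apply, dunklV_apply, map_sub, map_smul, map_smul, map_sum, pderiv_rename_perm]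
  congr 2
  refine (Finset.sum_bij (fun j _ => σ j) ?_ ?_ ?_ ?_).symm
  · intro j hj; simpa using hj
  · intro a _ b _ h; exact σ.injective h
  · intro b hb
    refine ⟨σ.symm b, ?_, by simp⟩
    simp only [Finset.mem_erase, Finset.mem_univ, and_true] at hb ⊢
    rintro rfl; simp at hb
  · intro j _; exact (divDiff_rename σ i j f).symm

theorem dunklV_X_mul_self (t c : k) (i : Fin n) (f : MvPolynomial (Fin n) k) :
    dunklV t c i (X i * f) = X i * dunklV t c i f + t • f
      - c • ∑ l ∈ Finset.univ.erase i, rename (Equiv.swap i l) f := by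
  have h : ∑ l ∈ Finset.univ.erase i, divDiff i l (X i * f)
      = X i * ∑ l ∈ Finset.univ.erase i, divDiff i l f
        + ∑ l ∈ Finset.univ.erase i, rename (Equiv.swap i l) f := by
    rw [Finset.mul_sum, ← Finset.sum_add_distrib]
    refine Finset.sum_congr rfl fun l hl => ?_
    have hl' : i ≠ l := (Finset.ne_of_mem_erase hl).symm
    rw [divDiff_X_mul i l hl', if_pos rfl, if_neg hl', sub_zero]
  rw [dunklV_apply, dunklV_apply, h, Derivation.leibniz, pderiv_X_self]
  simp only [smul_eq_mul, mul_one, smul_add, mul_sub, mul_smul_comm]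
  ring

theorem dunklV_X_mul_of_ne (t c : k) (i l : Fin n) (hl : l ≠ i) (f : MvPolynomial (Fin n) k) :
    dunklV t c i (X l * f) = X l * dunklV t c i f + c • rename (Equiv.swap i l) f := by
  have h : ∑ j ∈ Finset.univ.erase i, divDiff i j (X l * f)
      = X l * ∑ j ∈ Finset.univ.erase i, divDiff i j f - rename (Equiv.swap i l) f := by
    have h2 : ∀ j ∈ Finset.univ.erase i, divDiff i j (X l * f)
        = X l * divDiff i j f - (if l = j then rename (Equiv.swap i j) f else 0) := by
      intro j hj
      rw [divDiff_X_mul i j (Finset.ne_of_mem_erase hj).symm, if_neg hl, add_zero]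
    rw [Finset.sum_congr rfl h2, Finset.sum_sub_distrib, ← Finset.mul_sum,
      Finset.sum_ite_eq, if_pos (by simp [hl])]
  rw [dunklV_apply, dunklV_apply, h, Derivation.leibniz, pderiv_X_of_ne hl]
  simp only [smul_eq_mul, mul_zero, add_zero, mul_sub, mul_smul_comm, smul_sub]
  ring

theorem dunklV_C (t c : k) (i : Fin n) (a : k) : dunklV t c i (C a) = 0 := by
  rw [dunklV_apply]
  have h : ∀ j ∈ Finset.univ.erase i, divDiff i j (C a : MvPolynomial (Fin n) k) = 0 := by
    intro j hj
    have hij := (Finset.ne_of_mem_erase hj).symm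
    apply mul_left_cancel₀ (X_sub_X_ne_zero (k := k) i j hij)
    rw [divDiff_spec i j hij]; simp
  rw [Finset.sum_congr rfl h]
  simp

theorem dunklV_swap (t c : k) (i j : Fin n) (f : MvPolynomial (Fin n) k) :
    dunklV t c i (rename (Equiv.swap i j) f) = rename (Equiv.swap i j) (dunklV t c j f) := by
  have h := dunklV_rename t c (Equiv.swap i j) j f
  rwa [Equiv.swap_apply_right] at h

theorem dunklV_swap_of_ne (t c : k) (i j l : Fin n) (hi : i ≠ j) (hl : i ≠ l)
    (f : MvPolynomial (Fin n) k) :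
    dunklV t c i (rename (Equiv.swap j l) f) = rename (Equiv.swap j l) (dunklV t c i f) := by
  have h := dunklV_rename t c (Equiv.swap j l) i f
  rwa [Equiv.swap_apply_of_ne_of_ne hi hl] at h

/-- The Dunkl operators commute. -/
theorem dunklV_comm (t c : k) (i j : Fin n) (f : MvPolynomial (Fin n) k) :
    dunklV t c i (dunklV t c j f) = dunklV t c j (dunklV t c i f) := by
  rcases eq_or_ne i j with rfl | hij
  · rfl
  have key : ∀ (i j : Fin n), i ≠ j → ∀ f : MvPolynomial (Fin n) k,
      dunklV t c i (dunklV t c j f) = dunklV t c j (dunklV t c i f) →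
      dunklV t c i (dunklV t c j (X i * f)) = dunklV t c j (dunklV t c i (X i * f)) := by
    intro i j hij f hf
    rw [dunklV_X_mul_of_ne t c j i hij, dunklV_X_mul_self t c i f, map_add, map_sub, map_add,
      map_smul, map_smul, map_smul, map_sum, dunklV_X_mul_self, dunklV_X_mul_of_ne t c j i hij, hf,
      Equiv.swap_comm j i, dunklV_swap t c i j]
    have hmem : j ∈ Finset.univ.erase i := by simp [hij.symm]
    rw [← Finset.add_sum_erase _ _ hmem, ← Finset.add_sum_erase _ _ hmem]
    have h1 : dunklV t c j (rename (Equiv.swap i j) f)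
        = rename (Equiv.swap i j) (dunklV t c i f) := by
      rw [Equiv.swap_comm i j]; exact dunklV_swap t c j i f
    have h2 : ∀ l ∈ (Finset.univ.erase i).erase j, dunklV t c j (rename (Equiv.swap i l) f)
        = rename (Equiv.swap i l) (dunklV t c j f) := by
      intro l hl
      exact dunklV_swap_of_ne t c j i l hij.symm (Finset.ne_of_mem_erase hl).symm f
    rw [h1, Finset.sum_congr rfl h2, smul_add, smul_add]
    ring
  induction f using MvPolynomial.induction_on with
  | C a => simp [dunklV_C]
  | add p q hp hq => simp only [map_add, hp, hq]
  | mul_X p l hp =>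
    rw [mul_comm p (X l)]
    rcases eq_or_ne l i with rfl | hi
    · exact key l j hij p hp
    · rcases eq_or_ne l j with rfl | hj
      · exact (key l i hij.symm p hp.symm).symm
      · rw [dunklV_X_mul_of_ne t c j l hj, dunklV_X_mul_of_ne t c i l hi, map_add, map_add,
          map_smul, map_smul, dunklV_X_mul_of_ne t c j l hj, dunklV_X_mul_of_ne t c i l hi, hp,
          dunklV_swap_of_ne t c i j l hij hi.symm, dunklV_swap_of_ne t c j i l hij.symm hj.symm]
        ring

end Dunkl

section Representation

variable (k : Type*) [Field k] (n : ℕ)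

/-- The ideal `(x_1 + ⋯ + x_n)` of `k[x_1, …, x_n]`. -/
def sumIdeal : Ideal (MvPolynomial (Fin n) k) := Ideal.span {∑ i, X i}

/-- `S𝔥^* = k[x_1, …, x_n] / (x_1 + ⋯ + x_n)`, the space of the polynomial representation. -/
abbrev SymHDual : Type _ := MvPolynomial (Fin n) k ⧸ sumIdeal k n

variable {k n}

theorem mk_surj : Function.Surjective (Ideal.Quotient.mk (sumIdeal k n)) :=
  Ideal.Quotient.mk_surjective

/-- The operator induced on `S𝔥^*` by an operator on `k[x_1, …, x_n]` preserving the ideal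
`(x_1 + ⋯ + x_n)`. -/
def descend (T : Module.End k (MvPolynomial (Fin n) k))
    (hT : ∀ f ∈ sumIdeal k n, T f ∈ sumIdeal k n) : Module.End k (SymHDual k n) :=
  (((sumIdeal k n).restrictScalars k).liftQ
    ((Ideal.Quotient.mkₐ k (sumIdeal k n)).toLinearMap ∘ₗ T) (fun f hf => by
      simpa [Ideal.Quotient.eq_zero_iff_mem] using hT f hf)) ∘ₗ
    (Submodule.Quotient.restrictScalarsEquiv k (sumIdeal k n)).symm.toLinearMap

theorem descend_mk (T : Module.End k (MvPolynomial (Fin n) k))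
    (hT : ∀ f ∈ sumIdeal k n, T f ∈ sumIdeal k n) (f : MvPolynomial (Fin n) k) :
    descend T hT (Ideal.Quotient.mk _ f) = Ideal.Quotient.mk _ (T f) := rfl

theorem rename_sum_X (σ : Equiv.Perm (Fin n)) :
    rename σ (∑ i, X i : MvPolynomial (Fin n) k) = ∑ i, X i := by
  rw [map_sum]
  simp only [rename_X]
  exact Equiv.sum_comp σ (fun i => (X i : MvPolynomial (Fin n) k))

/-- The natural action of `S_n` on `S𝔥^*`: `σ x_i = x_{σ i}`. -/
def permOp (σ : Equiv.Perm (Fin n)) : Module.End k (SymHDual k n) :=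
  descend (rename σ).toLinearMap (fun f hf => by
    obtain ⟨g, rfl⟩ := Ideal.mem_span_singleton'.mp hf
    rw [AlgHom.toLinearMap_apply, map_mul, rename_sum_X]
    exact Ideal.mul_mem_left _ _ (Ideal.subset_span rfl))

theorem permOp_mk (σ : Equiv.Perm (Fin n)) (f : MvPolynomial (Fin n) k) :
    permOp σ (Ideal.Quotient.mk _ f) = Ideal.Quotient.mk _ (rename σ f) := rfl

theorem sum_eq_zero_of_mem_hSub {v : Fin n → k} (hv : v ∈ hSub k n) : ∑ i, v i = 0 := by
  induction hv using Submodule.span_induction with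
  | mem x hx =>
    obtain ⟨⟨i, j⟩, rfl⟩ := hx
    simp [Finset.sum_sub_distrib]
  | zero => simp
  | add x y _ _ hx hy => simp [Finset.sum_add_distrib, hx, hy]
  | smul a x _ hx => simp [← Finset.mul_sum, hx]

theorem dunklV_sum_mul (t c : k) (i : Fin n) (f : MvPolynomial (Fin n) k) :
    dunklV t c i (f * ∑ j, X j) = dunklV t c i f * ∑ j, X j + t • f := by
  have hmem : i ∈ (Finset.univ : Finset (Fin n)) := Finset.mem_univ i
  rw [mul_comm f, mul_comm (dunklV t c i f), Finset.sum_mul, Finset.sum_mul, map_sum,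
    ← Finset.add_sum_erase _ _ hmem, ← Finset.add_sum_erase _ _ hmem, dunklV_X_mul_self,
    Finset.sum_congr rfl fun l hl => dunklV_X_mul_of_ne t c i l (Finset.ne_of_mem_erase hl) f,
    Finset.sum_add_distrib, Finset.smul_sum]
  ring

/-- For `y = ∑ v_i y_i` in `𝔥`, the Dunkl operator `D_y = ∑ v_i D_{y_i}` on `S𝔥^*`. -/
def dunklFun (t c : k) (v : hSub k n) : Module.End k (SymHDual k n) :=
  descend (∑ i, (v : Fin n → k) i • dunklV t c i) (fun f hf => by
    obtain ⟨g, rfl⟩ := Ideal.mem_span_singleton'.mp hf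
    have h : (∑ i, (v : Fin n → k) i • dunklV t c i) (g * ∑ j, X j)
        = (∑ i, (v : Fin n → k) i • dunklV t c i g) * ∑ j, X j
          + (∑ i, (v : Fin n → k) i) • t • g := by
      rw [LinearMap.sum_apply, Finset.sum_mul, Finset.sum_smul, ← Finset.sum_add_distrib]
      refine Finset.sum_congr rfl fun i _ => ?_
      rw [LinearMap.smul_apply, dunklV_sum_mul, smul_add, smul_mul_assoc]
    rw [h, sum_eq_zero_of_mem_hSub v.2, zero_smul, add_zero]
    exact Ideal.mul_mem_left _ _ (Ideal.subset_span rfl))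

theorem dunklFun_mk (t c : k) (v : hSub k n) (f : MvPolynomial (Fin n) k) :
    dunklFun t c v (Ideal.Quotient.mk _ f)
      = Ideal.Quotient.mk _ (∑ i, (v : Fin n → k) i • dunklV t c i f) := by
  rw [dunklFun, descend_mk, LinearMap.sum_apply]
  simp only [LinearMap.smul_apply]

/-- The Dunkl operators, as a linear map `𝔥 → End(S𝔥^*)`, `y ↦ D_y`. -/
def dunkl (t c : k) : hSub k n →ₗ[k] Module.End k (SymHDual k n) where
  toFun := dunklFun t c
  map_add' v w := by
    refine LinearMap.ext fun q => ?_
    obtain ⟨f, rfl⟩ := mk_surj q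
    rw [LinearMap.add_apply, dunklFun_mk, dunklFun_mk, dunklFun_mk, ← map_add,
      ← Finset.sum_add_distrib]
    simp [add_smul]
  map_smul' a v := by
    refine LinearMap.ext fun q => ?_
    obtain ⟨f, rfl⟩ := mk_surj q
    rw [RingHom.id_apply, LinearMap.smul_apply, dunklFun_mk, dunklFun_mk,
      ← Ideal.Quotient.mkₐ_eq_mk k, ← map_smul, Finset.smul_sum]
    simp [mul_smul]

theorem dunkl_mk (t c : k) (v : hSub k n) (f : MvPolynomial (Fin n) k) :
    dunkl t c v (Ideal.Quotient.mk _ f)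
      = Ideal.Quotient.mk _ (∑ i, (v : Fin n → k) i • dunklV t c i f) :=
  dunklFun_mk t c v f

theorem dunkl_yDiff_mk (t c : k) (i j : Fin n) (f : MvPolynomial (Fin n) k) :
    dunkl t c (yDiff k n i j) (Ideal.Quotient.mk _ f)
      = Ideal.Quotient.mk _ (dunklV t c i f - dunklV t c j f) := by
  rw [dunkl_mk]
  congr 1
  simp [yDiff, sub_smul, Finset.sum_sub_distrib, Pi.single_apply, ite_smul]

theorem dunkl_comm (t c : k) (v w : hSub k n) :
    dunkl t c v * dunkl t c w = dunkl t c w * dunkl t c v := by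
  refine LinearMap.ext fun q => ?_
  obtain ⟨f, rfl⟩ := mk_surj q
  rw [Module.End.mul_apply, Module.End.mul_apply, dunkl_mk, dunkl_mk, dunkl_mk, dunkl_mk]
  congr 1
  simp only [map_sum, map_smul, Finset.smul_sum]
  rw [Finset.sum_comm]
  refine Finset.sum_congr rfl fun i _ => Finset.sum_congr rfl fun j _ => ?_
  rw [smul_comm, dunklV_comm]

variable (k n) in
/-- The inclusion `𝔥^* → S𝔥^*`. -/
def xLin : HDual k n →ₗ[k] SymHDual k n :=
  (Submodule.span k {(fun _ => 1 : Fin n → k)}).liftQ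
    ((Ideal.Quotient.mkₐ k (sumIdeal k n)).toLinearMap ∘ₗ
      Fintype.linearCombination k (fun i => (X i : MvPolynomial (Fin n) k))) (by
    rw [Submodule.span_le, Set.singleton_subset_iff, SetLike.mem_coe, LinearMap.mem_ker]
    simp only [LinearMap.comp_apply, Fintype.linearCombination_apply, one_smul,
      AlgHom.toLinearMap_apply, Ideal.Quotient.mkₐ_eq_mk]
    exact Ideal.Quotient.eq_zero_iff_mem.mpr (Ideal.subset_span rfl))

theorem xLin_xBar (i : Fin n) : xLin k n (xBar k n i) = Ideal.Quotient.mk (sumIdeal k n) (X i) := by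
  change Ideal.Quotient.mk (sumIdeal k n)
    (Fintype.linearCombination k (fun i => (X i : MvPolynomial (Fin n) k)) (Pi.single i 1)) = _
  rw [Fintype.linearCombination_apply_single, one_smul]

/-- How the generators act on `S𝔥^*`: `σ` naturally, `y` by `D_y`, `x` by multiplication. -/
def genOp (t c : k) : Gen k n → Module.End k (SymHDual k n)
  | .perm σ => permOp σ
  | .y v => dunkl t c v
  | .x w => LinearMap.mulLeft k (xLin k n w)

theorem genOp_rel (t c : k) ⦃a b : FreeAlgebra k (Gen k n)⦄ (h : Rel t c a b) :
    FreeAlgebra.lift k (genOp t c) a = FreeAlgebra.lift k (genOp t c) b := by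
  induction h with
  | y_add v w => simp [genOp]
  | y_smul a v => simp [genOp]
  | x_add v w => exact LinearMap.ext fun q => by simp [genOp, add_mul]
  | x_smul a v => exact LinearMap.ext fun q => by simpa [genOp] using smul_mul_assoc a _ q
  | perm_one =>
    simp only [FreeAlgebra.lift_ι_apply, genOp, map_one]
    refine LinearMap.ext fun q => ?_
    obtain ⟨f, rfl⟩ := mk_surj q
    rw [permOp_mk]
    simp
  | perm_mul σ τ =>
    simp only [FreeAlgebra.lift_ι_apply, genOp, map_mul]
    refine LinearMap.ext fun q => ?_
    obtain ⟨f, rfl⟩ := mk_surj q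
    rw [Module.End.mul_apply, permOp_mk, permOp_mk, permOp_mk, rename_rename]
    rfl
  | perm_y σ i j =>
    simp only [FreeAlgebra.lift_ι_apply, genOp, map_mul]
    refine LinearMap.ext fun q => ?_
    obtain ⟨f, rfl⟩ := mk_surj q
    rw [Module.End.mul_apply, Module.End.mul_apply, permOp_mk, dunkl_yDiff_mk, dunkl_yDiff_mk,
      permOp_mk, dunklV_rename, dunklV_rename, map_sub]
  | perm_x σ i =>
    simp only [FreeAlgebra.lift_ι_apply, genOp, map_mul]
    refine LinearMap.ext fun q => ?_
    obtain ⟨f, rfl⟩ := mk_surj q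
    rw [Module.End.mul_apply, Module.End.mul_apply, LinearMap.mulLeft_apply,
      LinearMap.mulLeft_apply, xLin_xBar, xLin_xBar, permOp_mk, ← map_mul, permOp_mk, ← map_mul,
      map_mul (rename σ), rename_X]
  | x_comm v w => exact LinearMap.ext fun q => by simp [genOp, mul_left_comm]
  | y_comm v w => simpa [genOp] using dunkl_comm t c v w
  | cross_self i j hij =>
    simp only [FreeAlgebra.lift_ι_apply, genOp, map_mul, map_sub, map_smul, map_sum,
      AlgHom.commutes]
    refine LinearMap.ext fun q => ?_
    obtain ⟨f, rfl⟩ := mk_surj q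
    simp only [LinearMap.sub_apply, Module.End.mul_apply, LinearMap.mulLeft_apply, xLin_xBar,
      LinearMap.smul_apply, LinearMap.sum_apply, permOp_mk, Module.algebraMap_end_apply]
    rw [← map_mul, dunkl_yDiff_mk, dunkl_yDiff_mk, dunklV_X_mul_self,
      dunklV_X_mul_of_ne t c j i hij, Equiv.swap_comm j i, ← map_mul, ← map_sub]
    simp only [← Ideal.Quotient.mkₐ_eq_mk k, ← map_smul, ← map_sum, ← map_sub]
    congr 1
    ring
  | cross_other i j l hi hj =>
    simp only [FreeAlgebra.lift_ι_apply, genOp, map_mul, map_sub, map_smul]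
    refine LinearMap.ext fun q => ?_
    obtain ⟨f, rfl⟩ := mk_surj q
    simp only [LinearMap.sub_apply, Module.End.mul_apply, LinearMap.mulLeft_apply, xLin_xBar,
      LinearMap.smul_apply, permOp_mk]
    rw [← map_mul, dunkl_yDiff_mk, dunkl_yDiff_mk, dunklV_X_mul_of_ne t c i l hi,
      dunklV_X_mul_of_ne t c j l hj, ← map_mul, ← map_sub]
    simp only [← Ideal.Quotient.mkₐ_eq_mk k, ← map_smul, ← map_sub]
    congr 1
    ring

variable (n) in
/-- The polynomial representation `H_{t,c}(S_n, 𝔥) → End(S𝔥^*)`. -/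
def polyRep (t c : k) : CherednikAlgebra k n t c →ₐ[k] Module.End k (SymHDual k n) :=
  RingQuot.liftAlgHom k ⟨FreeAlgebra.lift k (genOp t c), genOp_rel t c⟩

/-- The polynomial representation, as an `H_{t,c}(S_n, 𝔥)`-module structure on `S𝔥^*`. -/
instance polyModule (t c : k) : Module (CherednikAlgebra k n t c) (SymHDual k n) :=
  Module.compHom (SymHDual k n) (polyRep n t c).toRingHom

theorem cherednik_smul_def (t c : k) (a : CherednikAlgebra k n t c) (q : SymHDual k n) :
    a • q = polyRep n t c a q := rfl

instance polyModule_isScalarTower (t c : k) :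
    IsScalarTower k (CherednikAlgebra k n t c) (SymHDual k n) where
  smul_assoc a b q := by
    rw [cherednik_smul_def, cherednik_smul_def, map_smul, LinearMap.smul_apply]

end Representation

section ContravariantForm

variable {k : Type*} [Field k] {n : ℕ}

/-- The extension `S𝔥 → End(S𝔥^*)`, `f ↦ f(D)`, of `y ↦ D_y` to an algebra homomorphism. -/
def dunklHom (t c : k) : SymmetricAlgebra k (hSub k n) →ₐ[k] Module.End k (SymHDual k n) :=
  RingCon.liftₐEquiv (TensorAlgebra.symRingCon k (hSub k n)) ⟨TensorAlgebra.lift k (dunkl t c), by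
    refine RingCon.ringConGen_le.2 fun x y h => ?_
    induction h with
    | mul_comm v w =>
      rw [RingCon.ker_apply]
      simpa using dunkl_comm t c v w⟩

theorem dunklHom_ι (t c : k) (v : hSub k n) :
    dunklHom t c (SymmetricAlgebra.ι k _ v) = dunkl t c v := by
  exact TensorAlgebra.lift_ι_apply (dunkl t c) v

/-- The constant term `[x^0] q` of `q ∈ S𝔥^*`. -/
def constTerm : SymHDual k n →ₐ[k] k :=
  Ideal.Quotient.liftₐ (sumIdeal k n) (aeval (fun _ => (0 : k))) (fun f hf => by
    obtain ⟨g, rfl⟩ := Ideal.mem_span_singleton'.mp hf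
    simp)

variable (n) in
/-- The contravariant form `B(f, q) = [x^0] f(D) q` on `S𝔥 × S𝔥^*`. -/
def contravariantForm (t c : k) :
    SymmetricAlgebra k (hSub k n) →ₗ[k] SymHDual k n →ₗ[k] k :=
  (LinearMap.compRight k constTerm.toLinearMap) ∘ₗ (dunklHom t c).toLinearMap

theorem contravariantForm_apply (t c : k) (f : SymmetricAlgebra k (hSub k n))
    (q : SymHDual k n) : contravariantForm n t c f q = constTerm (dunklHom t c f q) := rfl

/-- The kernel of the contravariant form in its second argument, as a `k`-subspace. -/
def kerBSub (t c : k) : Submodule k (SymHDual k n) := LinearMap.ker (contravariantForm n t c).flip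

theorem mem_kerBSub (t c : k) (q : SymHDual k n) :
    q ∈ kerBSub t c ↔ ∀ f, contravariantForm n t c f q = 0 := by
  rw [kerBSub, LinearMap.mem_ker, LinearMap.ext_iff]
  rfl

theorem dunkl_mem_kerBSub (t c : k) (v : hSub k n) {q : SymHDual k n} (hq : q ∈ kerBSub t c) :
    dunkl t c v q ∈ kerBSub t c := by
  rw [mem_kerBSub] at hq ⊢
  intro f
  have h := hq (f * SymmetricAlgebra.ι k _ v)
  rwa [contravariantForm_apply, map_mul, dunklHom_ι, Module.End.mul_apply] at h

theorem constTerm_of_mem_kerBSub (t c : k) {q : SymHDual k n} (hq : q ∈ kerBSub t c) :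
    constTerm q = 0 := by
  have h := (mem_kerBSub t c q).mp hq 1
  rwa [contravariantForm_apply, map_one, Module.End.one_apply] at h

/-- A subspace stable under Dunkl operators and without constant terms lies in the kernel. -/
theorem le_kerBSub (t c : k) (N : Submodule k (SymHDual k n))
    (hD : ∀ i j, ∀ q ∈ N, dunkl t c (yDiff k n i j) q ∈ N)
    (h0 : ∀ q ∈ N, constTerm q = 0) : N ≤ kerBSub t c := by
  have hv : ∀ v : hSub k n, ∀ q ∈ N, dunkl t c v q ∈ N := by
    let P : Submodule k (hSub k n) :=
      { carrier := {v | ∀ q ∈ N, dunkl t c v q ∈ N}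
        add_mem' := fun {v w} hv hw q hq => by
          rw [map_add, LinearMap.add_apply]; exact N.add_mem (hv q hq) (hw q hq)
        zero_mem' := fun q _ => by rw [map_zero, LinearMap.zero_apply]; exact N.zero_mem
        smul_mem' := fun a v hv q hq => by
          rw [map_smul, LinearMap.smul_apply]; exact N.smul_mem a (hv q hq) }
    have hP : hSub k n ≤ P.map (hSub k n).subtype := by
      refine Submodule.span_le.mpr ?_
      rintro _ ⟨⟨i, j⟩, rfl⟩
      exact ⟨yDiff k n i j, hD i j, rfl⟩
    intro v
    obtain ⟨w, hw, hwv⟩ := hP v.2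
    have h : w = v := Subtype.ext hwv
    exact h ▸ hw
  have hf : ∀ f : SymmetricAlgebra k (hSub k n), ∀ q ∈ N, dunklHom t c f q ∈ N := by
    intro f
    induction f using SymmetricAlgebra.induction with
    | algebraMap r => intro q hq; rw [AlgHom.commutes]; exact N.smul_mem r hq
    | ι v => intro q hq; rw [dunklHom_ι]; exact hv v q hq
    | mul a b ha hb => intro q hq; rw [map_mul]; exact ha _ (hb q hq)
    | add a b ha hb => intro q hq; rw [map_add]; exact N.add_mem (ha q hq) (hb q hq)
  intro q hq
  rw [mem_kerBSub]
  intro f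
  exact h0 _ (hf f q hq)

theorem constTerm_mk (f : MvPolynomial (Fin n) k) :
    constTerm (Ideal.Quotient.mk (sumIdeal k n) f) = aeval (fun _ => (0 : k)) f := rfl

theorem permOp_mem_kerBSub (t c : k) (σ : Equiv.Perm (Fin n)) {q : SymHDual k n}
    (hq : q ∈ kerBSub t c) : permOp σ q ∈ kerBSub t c := by
  refine le_kerBSub t c ((kerBSub t c).map (permOp σ)) ?_ ?_ (Submodule.mem_map_of_mem hq)
  · rintro i j _ ⟨r, hr, rfl⟩
    refine ⟨_, dunkl_mem_kerBSub t c (yDiff k n (σ.symm i) (σ.symm j)) hr, ?_⟩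
    obtain ⟨f, rfl⟩ := mk_surj r
    have hi := dunklV_rename t c σ (σ.symm i) f
    have hj := dunklV_rename t c σ (σ.symm j) f
    rw [Equiv.apply_symm_apply] at hi hj
    rw [permOp_mk, dunkl_yDiff_mk, dunkl_yDiff_mk, permOp_mk, hi, hj, map_sub]
  · rintro _ ⟨r, hr, rfl⟩
    have h0 := constTerm_of_mem_kerBSub t c hr
    obtain ⟨f, rfl⟩ := mk_surj r
    rw [permOp_mk, constTerm_mk, aeval_rename]
    exact h0

theorem X_mul_mem_kerBSub (t c : k) (l : Fin n) {q : SymHDual k n}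
    (hq : q ∈ kerBSub t c) :
    Ideal.Quotient.mk (sumIdeal k n) (X l) * q ∈ kerBSub t c := by
  have hE : ∀ (i : Fin n) (f : MvPolynomial (Fin n) k),
      Ideal.Quotient.mk (sumIdeal k n) f ∈ kerBSub t c →
      ∃ e, Ideal.Quotient.mk (sumIdeal k n) e ∈ kerBSub t c ∧
        dunklV t c i (X l * f) = X l * dunklV t c i f + e := by
    intro i f hf
    have hs : ∀ σ : Equiv.Perm (Fin n),
        Ideal.Quotient.mk (sumIdeal k n) (rename σ f) ∈ kerBSub t c :=
      fun σ => permOp_mem_kerBSub t c σ hf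
    rcases eq_or_ne l i with rfl | hl
    · refine ⟨t • f - c • ∑ m ∈ Finset.univ.erase l, rename (Equiv.swap l m) f, ?_, ?_⟩
      · rw [← Ideal.Quotient.mkₐ_eq_mk k, map_sub, map_smul, map_smul, map_sum]
        exact Submodule.sub_mem _ (Submodule.smul_mem _ _ hf)
          (Submodule.smul_mem _ _ (Submodule.sum_mem _ fun m _ => hs _))
      · rw [dunklV_X_mul_self]; ring
    · refine ⟨c • rename (Equiv.swap i l) f, ?_, dunklV_X_mul_of_ne t c i l hl f⟩
      rw [← Ideal.Quotient.mkₐ_eq_mk k, map_smul]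
      exact Submodule.smul_mem _ _ (hs _)
  refine le_kerBSub t c (kerBSub t c ⊔ (kerBSub t c).map
    (LinearMap.mulLeft k (Ideal.Quotient.mk (sumIdeal k n) (X l)))) ?_ ?_
    (Submodule.mem_sup_right (Submodule.mem_map_of_mem hq))
  · intro i j r hr
    obtain ⟨a, ha, _, ⟨b, hb, rfl⟩, rfl⟩ := Submodule.mem_sup.mp hr
    have hDb := dunkl_mem_kerBSub t c (yDiff k n i j) hb
    rw [map_add]
    refine Submodule.add_mem _ (Submodule.mem_sup_left (dunkl_mem_kerBSub t c _ ha)) ?_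
    obtain ⟨f, rfl⟩ := mk_surj b
    obtain ⟨e, he, hei⟩ := hE i f hb
    obtain ⟨e', he', hej⟩ := hE j f hb
    rw [LinearMap.mulLeft_apply, ← map_mul, dunkl_yDiff_mk, hei, hej]
    rw [dunkl_yDiff_mk] at hDb
    have h : X l * dunklV t c i f + e - (X l * dunklV t c j f + e')
        = (e - e') + X l * (dunklV t c i f - dunklV t c j f) := by ring
    rw [h, map_add, map_sub, map_mul]
    exact Submodule.add_mem _ (Submodule.mem_sup_left (Submodule.sub_mem _ he he'))
      (Submodule.mem_sup_right (Submodule.mem_map_of_mem hDb))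
  · intro r hr
    obtain ⟨a, ha, _, ⟨b, hb, rfl⟩, rfl⟩ := Submodule.mem_sup.mp hr
    rw [map_add, constTerm_of_mem_kerBSub t c ha, LinearMap.mulLeft_apply, map_mul,
      constTerm_of_mem_kerBSub t c hb, mul_zero, add_zero]

theorem polyRep_mem_kerBSub (t c : k) (a : CherednikAlgebra k n t c) {q : SymHDual k n}
    (hq : q ∈ kerBSub t c) : polyRep n t c a q ∈ kerBSub t c := by
  obtain ⟨a, rfl⟩ := RingQuot.mkAlgHom_surjective k (Rel (k := k) (n := n) t c) a
  rw [polyRep, RingQuot.liftAlgHom_mkAlgHom_apply]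
  induction a using FreeAlgebra.induction generalizing q with
  | grade0 r => rw [AlgHom.commutes]; exact Submodule.smul_mem _ r hq
  | grade1 g =>
    rw [FreeAlgebra.lift_ι_apply]
    match g with
    | .perm σ => exact permOp_mem_kerBSub t c σ hq
    | .y v => exact dunkl_mem_kerBSub t c v hq
    | .x w =>
      obtain ⟨u, rfl⟩ := Submodule.Quotient.mk_surjective _ w
      have h : xLin k n (Submodule.Quotient.mk u)
          = ∑ i, u i • Ideal.Quotient.mk (sumIdeal k n) (X i) := by
        change Ideal.Quotient.mkₐ k (sumIdeal k n)
          (Fintype.linearCombination k (fun i => (X i : MvPolynomial (Fin n) k)) u) = _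
        rw [Fintype.linearCombination_apply, map_sum]
        simp only [map_smul, Ideal.Quotient.mkₐ_eq_mk]
      rw [genOp, LinearMap.mulLeft_apply, h, Finset.sum_mul]
      refine Submodule.sum_mem _ fun i _ => ?_
      rw [smul_mul_assoc]
      exact Submodule.smul_mem _ _ (X_mul_mem_kerBSub t c i hq)
  | mul a b ha hb => rw [map_mul]; exact ha (hb hq)
  | add a b ha hb => rw [map_add]; exact Submodule.add_mem _ (ha hq) (hb hq)

variable (n) in
/-- The kernel `ker B = {q ∈ S𝔥^* | B(f, q) = 0 for all f ∈ S𝔥}`, a subrepresentation of the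
polynomial representation. -/
def kerB (t c : k) : Submodule (CherednikAlgebra k n t c) (SymHDual k n) where
  carrier := {q | ∀ f, contravariantForm n t c f q = 0}
  add_mem' ha hb f := by rw [map_add, ha f, hb f, add_zero]
  zero_mem' f := map_zero _
  smul_mem' a q hq := by
    have h := polyRep_mem_kerBSub t c a ((mem_kerBSub t c q).mpr hq)
    exact (mem_kerBSub t c _).mp h

variable (n) in
/-- The quotient `L_{t,c} = S𝔥^* / ker B`, an `H_{t,c}(S_n, 𝔥)`-module. -/
abbrev IrredQuot (t c : k) : Type _ := SymHDual k n ⧸ kerB n t c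

variable (n) in
/-- The graded component `L_{t,c}[i]`: the classes of the homogeneous polynomials of degree `i`
in `x_1, …, x_n`. -/
def gradedPiece (t c : k) (i : ℕ) : Submodule k (IrredQuot n t c) :=
  (homogeneousSubmodule (Fin n) k i).map
    ((kerB n t c).mkQ.restrictScalars k ∘ₗ (Ideal.Quotient.mkₐ k (sumIdeal k n)).toLinearMap)

variable (n) in
/-- The Hilbert series `∑ dim L_{t,c}[i] z^i`. -/
def hilbertSeries (t c : k) : PowerSeries ℚ :=
  PowerSeries.mk fun i => (Module.finrank k (gradedPiece n t c i) : ℚ)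

end ContravariantForm

section Series

/-- The `z`-integer `[m]_z = (1 - z^m) / (1 - z)`. -/
def zInt (m : ℕ) : PowerSeries ℚ := (1 - PowerSeries.X ^ m) * (1 - PowerSeries.X)⁻¹

/-- The `z`-factorial `[r]_z! = [r]_z [r-1]_z ⋯ [1]_z`. -/
def zFactorial (r : ℕ) : PowerSeries ℚ := ∏ i ∈ Finset.Icc 1 r, zInt i

/-- The polynomial
`Q_r(n, z) = binom(n-1, r-1) z^(r+1) + ∑_{i=0}^r binom(n-r-2+i, i) z^i`,
where `binom(n-1, -1) = 0`. -/
def etingofRainsQ (r n : ℕ) : PowerSeries ℚ :=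
  (if r = 0 then 0 else ((n - 1).choose (r - 1) : PowerSeries ℚ)) * PowerSeries.X ^ (r + 1)
    + ∑ i ∈ Finset.range (r + 1),
      ((Ring.choose ((n : ℤ) - r - 2 + i) i : ℤ) : PowerSeries ℚ) * PowerSeries.X ^ i

/-- The series `[r]_z! [p]_z Q_r(n, z)` with `r` the residue of `n` modulo `p`, conjectured by
Etingof and Rains to be the Hilbert series of `L_{0,c}`. -/
def etingofRainsSeries (p n : ℕ) : PowerSeries ℚ :=
  zFactorial (n % p) * zInt p * etingofRainsQ (n % p) n

end Series

end RationalCherednik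

end

/-! The kernel of the form is detected by restriction to `n` lines. Let `u_m` be the vector with
coordinate `0` at place `m` and `1` elsewhere. Its coordinate sum is `n - 1 = 0` in `k`, so `u_m`
lies in the hyperplane where elements of `S𝔥^*` are functions. For a polynomial `f` and a degree
`d`, collect the values at the `u_m` of the degree `d` part of `f` into a vector of `k^n`.

The Dunkl operators act on these vectors (`lineCoeff_dunklV`). On the line through `u_m` with `i ≠
m`, the quotients with `x_i = x_l` become derivatives `∂_i f - ∂_l f`. Summed over `l ≠ i, m` they
give `(n - 1) ∂_i f` minus the Euler derivative along the line divided by the parameter. As `n = 1`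
in `k`, only the Euler part remains, and it depends only on values on the lines.

An element is in the kernel iff its constant term vanishes and all its Dunkl derivatives are in the
kernel. Hence the kernel is cut out by subspaces `R_d` of `k^n` with `R_0 = 0` and `R_{d+1}` the
vectors sent into `R_d` by every Dunkl operator. `mem_lineRadical_succ` solves this recursion: `0`
below degree `p`, the constants in degree `p`, the sum-zero vectors in degree `p + 1`, everything
later. `mk_mem_kerBSub_iff` transfers the result to polynomials.

Homogeneous polynomials of degree `d` realise the constants for `d = 0`, the sum-zero vectors for `d
= 1`, and all of `k^n` for `d ≥ 2`. Dividing by `R_d` gives the dimensions in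
`finrank_map_mkQ_lineRange`. Irreducibility follows by lowering degrees with Dunkl operators until a
nonzero constant appears. -/

namespace RationalCherednik

open MvPolynomial

/-! ### Restriction to lines and the induced Dunkl operators -/

section LineCoefficients

variable {k : Type*} [Field k] {n : ℕ}

/-- Restriction of a polynomial to the line spanned by the vector whose `m`-th coordinate is `0`
and whose other coordinates are `1`. -/
noncomputable def lineEval (m : Fin n) : MvPolynomial (Fin n) k →ₐ[k] Polynomial k :=
  aeval fun j => if j = m then 0 else Polynomial.X

/-- The values at the vectors `1 - e_m` of the homogeneous component of degree `d`. -/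
noncomputable def lineCoeff (d : ℕ) : MvPolynomial (Fin n) k →ₗ[k] (Fin n → k) :=
  LinearMap.pi fun m => Polynomial.lcoeff k d ∘ₗ (lineEval m).toLinearMap

theorem lineCoeff_apply (d : ℕ) (f : MvPolynomial (Fin n) k) (m : Fin n) :
    lineCoeff d f m = (lineEval m f).coeff d := rfl

theorem lineCoeff_zero_X_mul (l m : Fin n) (f : MvPolynomial (Fin n) k) :
    lineCoeff 0 (X l * f) m = 0 := by
  rw [lineCoeff_apply, map_mul, lineEval, aeval_X]
  split_ifs <;> simp

theorem lineCoeff_succ_X_mul (d : ℕ) (l m : Fin n) (f : MvPolynomial (Fin n) k) :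
    lineCoeff (d + 1) (X l * f) m = if l = m then 0 else lineCoeff d f m := by
  rw [lineCoeff_apply, lineCoeff_apply, map_mul, lineEval, aeval_X]
  split_ifs <;> simp

theorem lineCoeff_C (d : ℕ) (a : k) (m : Fin n) :
    lineCoeff d (C a) m = if d = 0 then a else 0 := by
  rw [lineCoeff_apply, lineEval, aeval_C, ← Polynomial.C_eq_algebraMap, Polynomial.coeff_C]

theorem lineCoeff_zero (f : MvPolynomial (Fin n) k) (m : Fin n) :
    lineCoeff 0 f m = aeval (fun _ => (0 : k)) f := by
  induction f using MvPolynomial.induction_on with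
  | C a => simp [lineCoeff_C]
  | add p q hp hq => simp [hp, hq]
  | mul_X p l hp => rw [mul_comm, lineCoeff_zero_X_mul]; simp

/-- Transpositions permute the `n` lines among themselves. -/
theorem lineCoeff_rename_swap (d : ℕ) (i l m : Fin n) (f : MvPolynomial (Fin n) k) :
    lineCoeff d (rename (Equiv.swap i l) f) m = lineCoeff d f (Equiv.swap i l m) := by
  have h : ((fun j => if j = m then 0 else Polynomial.X) ∘ (Equiv.swap i l) :
      Fin n → Polynomial k) = fun j => if j = Equiv.swap i l m then 0 else Polynomial.X := by
    funext j
    simp [Equiv.swap_apply_eq_iff]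
  rw [lineCoeff_apply, lineCoeff_apply, lineEval, lineEval, aeval_rename, h]

theorem sum_ite_zero_eq (l : Fin n) (v : Fin n → k) :
    ∑ j, (if l = j then 0 else v j) = ∑ j, v j - v l := by
  rw [eq_sub_iff_add_eq, ← Finset.sum_erase_add _ _ (Finset.mem_univ l),
    ← Finset.sum_erase_add (a := l) _ v (Finset.mem_univ l), if_pos rfl, add_zero]
  congr 1
  exact Finset.sum_congr rfl fun j hj => if_neg (Finset.ne_of_mem_erase hj).symm

theorem sum_erase_swap (i m : Fin n) (v : Fin n → k) :
    ∑ l ∈ Finset.univ.erase i, v (Equiv.swap i l m)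
      = if m = i then ∑ l, v l - v i else ((n : k) - 2) * v m + v i := by
  split_ifs with h
  · subst h
    rw [← Finset.sum_erase_add (a := m) _ v (Finset.mem_univ m), add_sub_cancel_right]
    exact Finset.sum_congr rfl fun l _ => by rw [Equiv.swap_apply_left]
  · have hm : m ∈ Finset.univ.erase i := by simp [h]
    have hn : 2 ≤ n := by
      have := i.isLt; have := m.isLt; have := Fin.val_ne_of_ne h; omega
    rw [← Finset.sum_erase_add _ _ hm, Equiv.swap_apply_right]
    congr 1
    rw [Finset.sum_congr rfl (g := fun _ => v m) fun l hl => by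
        rw [Equiv.swap_apply_of_ne_of_ne h (Finset.ne_of_mem_erase hl).symm],
      Finset.sum_const, Finset.card_erase_of_mem hm, Finset.card_erase_of_mem (Finset.mem_univ i),
      Finset.card_univ, Fintype.card_fin, nsmul_eq_mul, Nat.sub_sub, Nat.cast_sub hn]
    simp

/-- The map induced on the vectors `lineCoeff (d + 1) f` by the Dunkl operator `D_{y_i}` at
`t = 0`. -/
noncomputable def lineDunkl (c : k) (d : ℕ) (i : Fin n) (v : Fin n → k) : Fin n → k := fun m =>
  c * (d * v m + v i - if m = i then ∑ l, v l + d * v i else 0)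

/-- Induction on `f` through the commutation rules of Dunkl operators with multiplication by a
variable avoids any calculus with divided differences. The degree stays quantified because a factor
`X l` shifts it by one. -/
theorem lineCoeff_dunklV (hn : (n : k) = 1) (c : k) (i : Fin n) (f : MvPolynomial (Fin n) k) :
    ∀ d, lineCoeff d (dunklV 0 c i f) = lineDunkl c d i (lineCoeff (d + 1) f) := by
  induction f using MvPolynomial.induction_on with
  | C a =>
    intro d
    rw [dunklV_C, map_zero]
    funext m
    simp [lineDunkl, lineCoeff_C]
  | add p q hp hq =>
    intro d
    rw [map_add, map_add, map_add, hp, hq]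
    funext m
    simp only [lineDunkl, Pi.add_apply, Finset.sum_add_distrib]
    split_ifs <;> ring
  | mul_X f l hf =>
    intro d
    funext m
    rw [mul_comm f]
    have key : lineDunkl c d i (lineCoeff (d + 1) (X l * f)) m
        = c * (d * (if l = m then 0 else lineCoeff d f m) + (if l = i then 0 else lineCoeff d f i)
          - if m = i then ∑ j, lineCoeff d f j - lineCoeff d f l
              + d * (if l = i then 0 else lineCoeff d f i) else 0) := by
      rw [← sum_ite_zero_eq]
      simp only [lineDunkl, lineCoeff_succ_X_mul]
    -- The inductive hypothesis in degree `d - 1`. For `d = 0` the bracket must vanish on its own: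
    -- the vector is then constant, and `n = 1` makes the `m = i` entry zero.
    have hD : lineCoeff d (X l * dunklV 0 c i f) m = if l = m then 0 else
        c * ((d - 1) * lineCoeff d f m + lineCoeff d f i -
          if m = i then ∑ l, lineCoeff d f l + (d - 1) * lineCoeff d f i else 0) := by
      cases d with
      | zero =>
        rw [lineCoeff_zero_X_mul]
        simp [lineCoeff_zero, hn]
      | succ d =>
        rw [lineCoeff_succ_X_mul, hf]
        simp [lineDunkl]
    rw [key]
    rcases eq_or_ne l i with rfl | hl
    · rw [dunklV_X_mul_self, zero_smul, add_zero, map_sub, map_smul, map_sum, Pi.sub_apply, hD,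
        Pi.smul_apply, Finset.sum_apply]
      simp only [lineCoeff_rename_swap, smul_eq_mul]
      rw [sum_erase_swap, hn]
      by_cases hm : m = l
      · subst hm; simp only [if_true]; ring
      · simp only [if_neg hm, if_neg (Ne.symm hm), if_true]; ring
    · rw [dunklV_X_mul_of_ne 0 c i l hl, map_add, map_smul, Pi.add_apply, hD, Pi.smul_apply,
        lineCoeff_rename_swap, smul_eq_mul, if_neg hl]
      by_cases hm : m = i
      · subst hm; simp only [if_true, if_neg hl, Equiv.swap_apply_left]; ring
      · by_cases hml : m = l
        · subst hml; simp only [if_true, if_neg hl, Equiv.swap_apply_right]; ring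
        · rw [Equiv.swap_apply_of_ne_of_ne hm hml]
          simp only [if_neg hm, if_neg (Ne.symm hml)]; ring

/-- The shadow of `∑ D_{y_i} = 0`, valid at `t = 0` because the divided differences are
antisymmetric in their two indices. -/
theorem sum_lineDunkl (hn : (n : k) = 1) (c : k) (d : ℕ) (v : Fin n → k) :
    ∑ i, lineDunkl c d i v = 0 := by
  funext m
  simp only [Finset.sum_apply, lineDunkl, Pi.zero_apply, ← Finset.mul_sum]
  rw [Finset.sum_sub_distrib, Finset.sum_add_distrib, Finset.sum_ite_eq]
  simp only [Finset.sum_const, Finset.card_univ, Fintype.card_fin, nsmul_eq_mul, hn,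
    Finset.mem_univ, if_true]
  ring

theorem lineCoeff_homogeneous {d e : ℕ} (hde : e ≠ d) {f : MvPolynomial (Fin n) k}
    (hf : f.IsHomogeneous d) : lineCoeff e f = 0 := by
  have h : ∀ m : Fin n, lineEval m f
      = Polynomial.C (aeval (fun j => if j = m then (0 : k) else 1) f) * Polynomial.X ^ d := by
    intro m
    rw [lineEval, aeval_def, aeval_def, eval₂_eq, eval₂_eq, map_sum, Finset.sum_mul]
    refine Finset.sum_congr rfl fun s hs => ?_
    have hd := hf (mem_support_iff.mp hs)
    rw [Finsupp.weight_apply, Finsupp.sum] at hd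
    have h1 : ∀ j : Fin n, (if j = m then 0 else Polynomial.X : Polynomial k)
        = Polynomial.C (if j = m then (0 : k) else 1) * Polynomial.X := by
      intro j; split_ifs <;> simp
    simp only [h1, mul_pow, Finset.prod_mul_distrib, Finset.prod_pow_eq_pow_sum, map_mul, map_prod,
      map_pow]
    simp only [smul_eq_mul, Pi.one_apply, mul_one] at hd
    rw [hd, mul_assoc]
    rfl
  funext m
  rw [lineCoeff_apply, h, Polynomial.coeff_C_mul_X_pow, if_neg hde, Pi.zero_apply]

end LineCoefficients

/-! ### Solving the recursion for the radical, and the image of homogeneous polynomials -/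

section LineRadical

variable {k : Type*} [Field k] {n : ℕ}

/-- The sum of the coordinates, as a linear functional. -/
noncomputable def coordSum : (Fin n → k) →ₗ[k] k := ∑ i, LinearMap.proj i

theorem coordSum_apply (v : Fin n → k) : coordSum v = ∑ i, v i := by
  simp [coordSum]

variable (k n) in
/-- The vectors `lineCoeff d f` for `f` in the kernel of the contravariant form. -/
noncomputable def lineRadical (p d : ℕ) : Submodule k (Fin n → k) :=
  if d < p then ⊥ else if d = p then k ∙ (1 : Fin n → k)
    else if d = p + 1 then LinearMap.ker coordSum else ⊤

theorem lineRadical_of_lt {p d : ℕ} (h : d < p) : lineRadical k n p d = ⊥ := if_pos h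

theorem lineRadical_self (p : ℕ) : lineRadical k n p p = k ∙ (1 : Fin n → k) := by
  simp [lineRadical]

theorem lineRadical_succ_self (p : ℕ) :
    lineRadical k n p (p + 1) = LinearMap.ker coordSum := by
  simp [lineRadical]

theorem lineRadical_of_le {p d : ℕ} (h : p + 2 ≤ d) : lineRadical k n p d = ⊤ := by
  rw [lineRadical, if_neg (by omega), if_neg (by omega), if_neg (by omega)]

/-- The factor `d - 1` vanishes for `d = p + 1`; this is what ends the recursion with the whole
space in degree `p + 2`. -/
theorem coordSum_lineDunkl (hn : (n : k) = 1) (c : k) (d : ℕ) (i : Fin n) (v : Fin n → k) :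
    coordSum (lineDunkl c d i v) = c * (d - 1) * (∑ l, v l - v i) := by
  rw [coordSum_apply]
  simp only [lineDunkl, ← Finset.mul_sum]
  rw [Finset.sum_sub_distrib, Finset.sum_add_distrib, Finset.sum_ite_eq', ← Finset.mul_sum]
  simp only [Finset.sum_const, Finset.card_univ, Fintype.card_fin, nsmul_eq_mul, hn,
    Finset.mem_univ, if_true]
  ring

/-- A vector annihilated by all the operators `lineDunkl c d i` is constant. -/
theorem eq_of_lineDunkl_eq_zero (hn3 : 3 ≤ n) {c : k} (hc : c ≠ 0) {d : ℕ} {v : Fin n → k}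
    (h : ∀ i, lineDunkl c d i v = 0) : (∀ i j, v i = v j) ∧ ∀ i, ((d + 1 : ℕ) : k) * v i = 0 := by
  have h1 : ∀ i m, m ≠ i → d * v m + v i = 0 := by
    intro i m hm
    have := congrFun (h i) m
    simpa [lineDunkl, hm, hc] using this
  have h2 : ∀ i j, v i = v j := by
    intro i j
    -- Comparing `v i` with `v j` needs a third index, which `3 ≤ n` supplies.
    obtain ⟨m, hm⟩ : ∃ m : Fin n, m ∉ ({i, j} : Finset (Fin n)) := by
      by_contra! hall
      have h3 := Finset.card_le_two (a := i) (b := j)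
      rw [Finset.eq_univ_of_forall hall, Finset.card_univ, Fintype.card_fin] at h3
      omega
    simp only [Finset.mem_insert, Finset.mem_singleton, not_or] at hm
    have hi := h1 i m hm.1
    have hj := h1 j m hm.2
    exact add_left_cancel (hi.trans hj.symm)
  refine ⟨h2, fun i => ?_⟩
  obtain ⟨m, hm⟩ : ∃ m : Fin n, m ≠ i := by
    have : Nontrivial (Fin n) := Fin.nontrivial_iff_two_le.mpr (by omega)
    exact exists_ne i
  have hi := h1 i m hm
  rw [h2 m i] at hi
  push_cast
  linear_combination hi

/-- Below degree `p` the scalar `d + 1` is invertible, so no nonzero vector is annihilated. When `d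
+ 1 = p` it vanishes and the constants appear. After that, the vanishing of `d` at `d = p` and of `d
- 1` at `d = p + 1` enlarges the radical to the sum-zero vectors and then to everything. -/
theorem mem_lineRadical_succ {p : ℕ} [Fact p.Prime] [CharP k p] (hn3 : 3 ≤ n) (hn : (n : k) = 1)
    {c : k} (hc : c ≠ 0) (d : ℕ) (v : Fin n → k) :
    v ∈ lineRadical k n p (d + 1) ↔ ∀ i, lineDunkl c d i v ∈ lineRadical k n p d := by
  have hp0 : (p : k) = 0 := CharP.cast_eq_zero k p
  rcases lt_trichotomy (d + 1) p with hd | hd | hd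
  · rw [lineRadical_of_lt hd, lineRadical_of_lt (by omega)]
    simp only [Submodule.mem_bot]
    constructor
    · rintro rfl i
      funext m
      simp [lineDunkl]
    · intro h
      have hd0 : ((d + 1 : ℕ) : k) ≠ 0 := by
        rw [Ne, CharP.cast_eq_zero_iff k p]
        exact Nat.not_dvd_of_pos_of_lt d.succ_pos hd
      funext i
      exact (mul_eq_zero.mp ((eq_of_lineDunkl_eq_zero hn3 hc h).2 i)).resolve_left hd0
  · have hd1 : (d : k) + 1 = 0 := by rw [← hp0, ← hd]; push_cast; rfl
    rw [hd, lineRadical_self, lineRadical_of_lt (by omega), Submodule.mem_span_singleton]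
    simp only [Submodule.mem_bot]
    constructor
    · rintro ⟨a, rfl⟩ i
      funext m
      simp only [lineDunkl, Pi.smul_apply, Pi.one_apply, smul_eq_mul, mul_one, Finset.sum_const,
        Finset.card_univ, Fintype.card_fin, nsmul_eq_mul, hn, Pi.zero_apply]
      split_ifs
      · ring
      · linear_combination c * a * hd1
    · intro h
      refine ⟨v ⟨0, by omega⟩, ?_⟩
      funext i
      simp [(eq_of_lineDunkl_eq_zero hn3 hc h).1 i ⟨0, by omega⟩]
  · obtain ⟨e, rfl⟩ : ∃ e, d = p + e := ⟨d - p, by omega⟩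
    match e with
    | 0 =>
      rw [add_zero, lineRadical_succ_self, lineRadical_self, LinearMap.mem_ker, coordSum_apply]
      have hT : ∀ i m, lineDunkl c p i v m = c * (v i - if m = i then ∑ l, v l else 0) := by
        intro i m
        simp [lineDunkl]
      constructor
      · intro h i
        refine Submodule.mem_span_singleton.mpr ⟨c * v i, ?_⟩
        funext m
        simp [hT, h]
      · intro h
        -- For `d = p`, the image under the operator of index `0` is constant off entry `0`, and
        -- entry `0` deviates by `c` times the coordinate sum. Comparing two entries isolates that
        -- sum.
        obtain ⟨a, ha⟩ := Submodule.mem_span_singleton.mp (h ⟨0, by omega⟩)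
        have h0 := congrFun ha ⟨0, by omega⟩
        have h1 := congrFun ha ⟨1, by omega⟩
        rw [hT] at h0 h1
        rw [if_pos rfl] at h0
        rw [if_neg (by simp)] at h1
        simp only [Pi.smul_apply, Pi.one_apply] at h0 h1
        have h2 : c * ∑ l, v l = 0 := by linear_combination h0 - h1
        exact (mul_eq_zero.mp h2).resolve_left hc
    | 1 =>
      rw [lineRadical_of_le (by omega), lineRadical_succ_self]
      refine ⟨fun _ i => ?_, fun _ => trivial⟩
      rw [LinearMap.mem_ker, coordSum_lineDunkl hn]
      simp
    | e + 2 =>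
      rw [lineRadical_of_le (by omega), lineRadical_of_le (by omega)]
      simp

theorem lineRadical_finrank_lt {p d : ℕ} (h : d < p) :
    Module.finrank k (lineRadical k n p d) = 0 := by
  rw [lineRadical_of_lt h, finrank_bot]

theorem finrank_ker_coordSum (hn : 0 < n) :
    Module.finrank k (LinearMap.ker (coordSum : (Fin n → k) →ₗ[k] k)) + 1 = n := by
  have h : (coordSum : Module.Dual k (Fin n → k)) ≠ 0 := by
    intro h0
    have h1 := LinearMap.congr_fun h0 (Pi.single ⟨0, hn⟩ 1)
    have h2 := coordSum_apply (Pi.single ⟨0, hn⟩ 1 : Fin n → k)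
    rw [Finset.sum_pi_single'] at h2
    simp at h2
    simp_all
  rw [Module.Dual.finrank_ker_add_one_of_ne_zero h, Module.finrank_fin_fun]

variable (k n) in
/-- The vectors `lineCoeff d f` for `f` homogeneous of degree `d`. -/
noncomputable def lineRange (d : ℕ) : Submodule k (Fin n → k) :=
  (homogeneousSubmodule (Fin n) k d).map (lineCoeff d)

theorem lineRange_zero : lineRange k n 0 = k ∙ (1 : Fin n → k) := by
  refine le_antisymm ?_ ?_
  · rintro _ ⟨f, -, rfl⟩
    refine Submodule.mem_span_singleton.mpr ⟨aeval (fun _ => (0 : k)) f, ?_⟩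
    funext m
    simp [lineCoeff_zero]
  · rw [Submodule.span_singleton_le_iff_mem]
    refine ⟨1, isHomogeneous_one _ _, ?_⟩
    funext m
    simp [lineCoeff_zero]

theorem lineRange_one (hn2 : 2 ≤ n) (hn : (n : k) = 1) :
    lineRange k n 1 = LinearMap.ker coordSum := by
  refine le_antisymm ?_ ?_
  · rintro _ ⟨f, -, rfl⟩
    rw [LinearMap.mem_ker, coordSum_apply]
    -- A Dunkl derivative has the same constant term on every line. Equating two entries of the
    -- induced formula, with auxiliary parameter `c = 1`, forces the coordinate sum to vanish.
    have h := lineCoeff_dunklV hn 1 ⟨0, by omega⟩ f 0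
    have h0 := congrFun h ⟨0, by omega⟩
    have h1 := congrFun h ⟨1, by omega⟩
    rw [lineCoeff_zero] at h0 h1
    have h2 := h0.symm.trans h1
    simpa [lineDunkl] using h2
  · intro v hv
    rw [LinearMap.mem_ker, coordSum_apply] at hv
    -- At `u_m` this form equals `v m` minus the coordinate sum of `v`, which is zero.
    refine ⟨∑ j, (-v j) • X j, ?_, ?_⟩
    · exact Submodule.sum_mem _ fun j _ => Submodule.smul_mem _ _ (isHomogeneous_X k j)
    · funext m
      rw [map_sum, Finset.sum_apply]
      have h : ∀ j, lineCoeff 1 ((-v j) • X j : MvPolynomial (Fin n) k) m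
          = -(if m = j then 0 else v j) := by
        intro j
        rw [← mul_one (X j), map_smul, Pi.smul_apply, lineCoeff_succ_X_mul, lineCoeff_zero]
        by_cases hj : j = m
        · simp [hj]
        · simp [hj, Ne.symm hj]
      rw [Finset.sum_congr rfl fun j _ => h j, Finset.sum_neg_distrib, sum_ite_zero_eq, hv]
      ring

theorem lineRange_add_two (hn2 : 2 ≤ n) (d : ℕ) : lineRange k n (d + 2) = ⊤ := by
  have h : ∀ j : Fin n, Pi.single j 1 ∈ lineRange k n (d + 2) := by
    intro j
    have : Nontrivial (Fin n) := Fin.nontrivial_iff_two_le.mpr hn2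
    obtain ⟨l, hl⟩ := exists_ne j
    -- The first factor vanishes at `u_l`; the second vanishes at every `u_m` with `m ≠ l, j`. Only
    -- the value `1` at `u_j` survives.
    refine ⟨X l ^ (d + 1) * (X l - X j), ?_, ?_⟩
    · have h1 : (X l ^ (d + 1) * (X l - X j) : MvPolynomial (Fin n) k).IsHomogeneous
          (1 * (d + 1) + 1) :=
        ((isHomogeneous_X k l).pow (d + 1)).mul ((isHomogeneous_X k l).sub (isHomogeneous_X k j))
      rwa [one_mul] at h1
    · funext m
      rw [lineCoeff_apply, map_mul, map_pow, map_sub, lineEval, aeval_X, aeval_X]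
      by_cases hm : l = m
      · subst hm
        simp [hl]
      · by_cases hj : j = m
        · subst hj
          simp [hl, ← pow_succ]
        · simp [hm, hj, Ne.symm hj]
  rw [eq_top_iff]
  intro v _
  rw [pi_eq_sum_univ' v]
  refine Submodule.sum_mem _ fun j _ => ?_
  have h2 := Submodule.smul_mem _ (v j) (h j)
  convert h2 using 2

theorem finrank_map_mkQ_add {V : Type*} [AddCommGroup V] [Module k V] [FiniteDimensional k V]
    {W R : Submodule k V} (h : W ≤ R) :
    Module.finrank k (R.map W.mkQ) + Module.finrank k W = Module.finrank k R := by
  rw [← LinearMap.finrank_range_add_finrank_ker (W.mkQ.domRestrict R), LinearMap.range_domRestrict,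
    LinearMap.ker_domRestrict, Submodule.ker_mkQ]
  congr 1
  exact (Submodule.comapSubtypeEquivOfLe h).finrank_eq.symm

/-- The dimensions are `n` in the middle degrees, with drops in degrees `0, 1` from the image and in
degrees `p, p + 1` from the radical. The right side is the coefficient of `z^d` in `[p]_z (1 + (n-2)
z + z^2)`; the bounds `1 ≤ d` and `2 ≤ d` guard the truncated subtractions. -/
theorem finrank_map_mkQ_lineRange {p : ℕ} (hp : 2 ≤ p) (hn2 : 2 ≤ n) (hn : (n : k) = 1) (d : ℕ) :
    (Module.finrank k ((lineRange k n d).map (lineRadical k n p d).mkQ) : ℤ)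
      = (if d < p then 1 else 0) + (n - 2) * (if 1 ≤ d ∧ d - 1 < p then 1 else 0)
        + (if 2 ≤ d ∧ d - 2 < p then 1 else 0) := by
  have h1 : Module.finrank k (k ∙ (1 : Fin n → k)) = 1 := by
    refine finrank_span_singleton fun h => ?_
    simpa using congrFun h ⟨0, by omega⟩
  have hker := finrank_ker_coordSum (k := k) (n := n) (by omega)
  -- The image is proper only in degrees `0` and `1`, where the radical is zero because `2 ≤ p`.
  have hle : lineRadical k n p d ≤ lineRange k n d := by
    match d with
    | 0 => rw [lineRadical_of_lt (by omega)]; exact bot_le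
    | 1 => rw [lineRadical_of_lt (by omega)]; exact bot_le
    | d + 2 => rw [lineRange_add_two hn2]; exact le_top
  have hR := finrank_map_mkQ_add hle
  match d with
  | 0 =>
    rw [lineRange_zero, h1, lineRadical_finrank_lt (by omega)] at hR
    rw [lineRange_zero]
    simp
    omega
  | 1 =>
    rw [lineRange_one hn2 hn, lineRadical_finrank_lt (by omega)] at hR
    rw [lineRange_one hn2 hn]
    simp
    split_ifs <;> omega
  | d + 2 =>
    rw [lineRange_add_two hn2, finrank_top, Module.finrank_fin_fun] at hR
    rw [lineRange_add_two hn2]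
    rcases lt_trichotomy (d + 2) p with hd | hd | hd
    · rw [lineRadical_finrank_lt hd] at hR
      rw [if_pos hd, if_pos (by omega), if_pos (by omega)]
      omega
    · subst hd
      rw [lineRadical_self, h1] at hR
      rw [lineRadical_self, if_neg (by omega), if_pos (by omega), if_pos (by omega)]
      omega
    · rcases Nat.lt_or_ge (d + 2) (p + 2) with hd' | hd'
      · obtain rfl : p = d + 1 := by omega
        rw [lineRadical_succ_self] at hR
        rw [lineRadical_succ_self, if_neg (by omega), if_neg (by omega), if_pos (by omega)]
        omega
      · rw [lineRadical_of_le hd', finrank_top, Module.finrank_fin_fun] at hR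
        rw [lineRadical_of_le hd', if_neg (by omega), if_neg (by omega), if_neg (by omega)]
        omega

end LineRadical

/-! ### The kernel of the form and irreducibility -/

section Kernel

variable {k : Type*} [Field k] {n : ℕ}

/-- Only the differences `D_{y_i} - D_{y_j}` act on `S𝔥^*`. Summing them over `j` gives `n D_{y_i} -
∑ D_{y_j} = D_{y_i}`, so each single operator is recovered. -/
theorem lineDunkl_mem_of_sub_mem (hn : (n : k) = 1) {c : k} {d : ℕ} {v : Fin n → k}
    {W : Submodule k (Fin n → k)} (h : ∀ i j, lineDunkl c d i v - lineDunkl c d j v ∈ W)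
    (i : Fin n) : lineDunkl c d i v ∈ W := by
  have h1 := Submodule.sum_mem W fun j (_ : j ∈ Finset.univ) => h i j
  rwa [Finset.sum_sub_distrib, sum_lineDunkl hn, sub_zero, Finset.sum_const, Finset.card_univ,
    Fintype.card_fin, ← Nat.cast_smul_eq_nsmul k, hn, one_smul] at h1

/-- Both directions follow the recursion. The kernel is stable under Dunkl operators and has no
constant terms, which bounds it degree by degree; conversely the polynomials satisfying the line
conditions form such a stable subspace, so `le_kerBSub` applies. -/
theorem mk_mem_kerBSub_iff {p : ℕ} [Fact p.Prime] [CharP k p] (hn3 : 3 ≤ n) (hn : (n : k) = 1)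
    {c : k} (hc : c ≠ 0) (f : MvPolynomial (Fin n) k) :
    Ideal.Quotient.mk (sumIdeal k n) f ∈ kerBSub 0 c
      ↔ ∀ d, lineCoeff d f ∈ lineRadical k n p d := by
  have hp := (Fact.out : p.Prime).pos
  constructor
  · intro hf d
    induction d generalizing f with
    | zero =>
      rw [lineRadical_of_lt hp, Submodule.mem_bot]
      funext m
      rw [lineCoeff_zero, ← constTerm_mk]
      exact constTerm_of_mem_kerBSub 0 c hf
    | succ d ih =>
      rw [mem_lineRadical_succ hn3 hn hc]
      refine lineDunkl_mem_of_sub_mem hn fun i j => ?_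
      have h := ih _ (dunkl_yDiff_mk 0 c i j f ▸ dunkl_mem_kerBSub 0 c (yDiff k n i j) hf)
      rwa [map_sub, lineCoeff_dunklV hn, lineCoeff_dunklV hn] at h
  · intro hf
    let N : Submodule k (MvPolynomial (Fin n) k) := ⨅ d, (lineRadical k n p d).comap (lineCoeff d)
    have hN : ∀ f, f ∈ N ↔ ∀ d, lineCoeff d f ∈ lineRadical k n p d := by
      intro f; simp [N]
    refine le_kerBSub 0 c (N.map (Ideal.Quotient.mkₐ k (sumIdeal k n)).toLinearMap) ?_ ?_
      (Submodule.mem_map_of_mem ((hN f).mpr hf))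
    · rintro i j _ ⟨g, hg, rfl⟩
      refine ⟨dunklV 0 c i g - dunklV 0 c j g, ?_, (dunkl_yDiff_mk 0 c i j g).symm⟩
      have hg' := (hN g).mp hg
      refine (hN _).mpr fun d => ?_
      rw [map_sub, lineCoeff_dunklV hn, lineCoeff_dunklV hn]
      have h := (mem_lineRadical_succ hn3 hn hc d _).mp (hg' (d + 1))
      exact Submodule.sub_mem _ (h i) (h j)
    · rintro _ ⟨g, hg, rfl⟩
      have h := (hN g).mp hg 0
      rw [lineRadical_of_lt hp, Submodule.mem_bot] at h
      have h0 := congrFun h ⟨0, by omega⟩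
      rw [lineCoeff_zero] at h0
      exact h0

theorem algebraMap_mul_mem {t c : k} (M : Submodule (CherednikAlgebra k n t c) (SymHDual k n))
    (a : k) {q : SymHDual k n} (hq : q ∈ M) : algebraMap k (SymHDual k n) a * q ∈ M := by
  rw [← Algebra.smul_def]
  exact M.smul_of_tower_mem a hq

/-- A subrepresentation of the polynomial representation containing `1` is everything. -/
theorem eq_top_of_one_mem {t c : k} (M : Submodule (CherednikAlgebra k n t c) (SymHDual k n))
    (h1 : 1 ∈ M) : M = ⊤ := by
  rw [eq_top_iff]
  rintro q -
  obtain ⟨f, rfl⟩ := mk_surj q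
  induction f using MvPolynomial.induction_on with
  | C a =>
    have h := algebraMap_mul_mem M a h1
    rwa [mul_one] at h
  | add f g hf hg => rw [map_add]; exact M.add_mem hf hg
  | mul_X f l hf =>
    have h := M.smul_mem (RingQuot.mkAlgHom k (Rel t c) (gX (xBar k n l))) hf
    rw [cherednik_smul_def, polyRep, RingQuot.liftAlgHom_mkAlgHom_apply, FreeAlgebra.lift_ι_apply,
      genOp, LinearMap.mulLeft_apply, xLin_xBar] at h
    rwa [map_mul, mul_comm]

theorem dunkl_mem {t c : k} (M : Submodule (CherednikAlgebra k n t c) (SymHDual k n))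
    (v : hSub k n) {q : SymHDual k n} (hq : q ∈ M) : dunkl t c v q ∈ M := by
  have h := M.smul_mem (RingQuot.mkAlgHom k (Rel t c) (gY v)) hq
  rwa [cherednik_smul_def, polyRep, RingQuot.liftAlgHom_mkAlgHom_apply,
    FreeAlgebra.lift_ι_apply] at h

theorem mem_kerB (t c : k) (q : SymHDual k n) : q ∈ kerB n t c ↔ q ∈ kerBSub t c :=
  (mem_kerBSub t c q).symm

/-- A polynomial without constant term, all of whose Dunkl derivatives lie in the kernel of the
contravariant form, lies in that kernel. -/
theorem mem_kerBSub_of_dunkl_mem {t c : k} {q : SymHDual k n} (h0 : constTerm q = 0)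
    (hq : ∀ i j, dunkl t c (yDiff k n i j) q ∈ kerBSub t c) : q ∈ kerBSub t c := by
  refine le_kerBSub t c (kerBSub t c ⊔ k ∙ q) ?_ ?_
    (Submodule.mem_sup_right (Submodule.mem_span_singleton_self q))
  · intro i j r hr
    obtain ⟨u, hu, w, hw, rfl⟩ := Submodule.mem_sup.mp hr
    obtain ⟨a, rfl⟩ := Submodule.mem_span_singleton.mp hw
    rw [map_add, map_smul]
    exact Submodule.mem_sup_left (Submodule.add_mem _ (dunkl_mem_kerBSub t c _ hu)
      (Submodule.smul_mem _ _ (hq i j)))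
  · intro r hr
    obtain ⟨u, hu, w, hw, rfl⟩ := Submodule.mem_sup.mp hr
    obtain ⟨a, rfl⟩ := Submodule.mem_span_singleton.mp hw
    rw [map_add, map_smul, constTerm_of_mem_kerBSub t c hu, h0, smul_zero, add_zero]

/-- A submodule strictly above the kernel contains an element outside the kernel; Dunkl operators
lower it, staying outside the kernel, until a nonzero constant is reached, and constants generate.
-/
theorem isSimpleModule_irredQuot {p : ℕ} [Fact p.Prime] [CharP k p] (hn3 : 3 ≤ n)
    (hn : (n : k) = 1) {c : k} (hc : c ≠ 0) :
    IsSimpleModule (CherednikAlgebra k n 0 c) (IrredQuot n 0 c) := by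
  rw [isSimpleModule_iff_isCoatom]
  refine ⟨fun h => ?_, fun M hM => ?_⟩
  · have h1 : (1 : SymHDual k n) ∈ kerB n 0 c := h ▸ Submodule.mem_top
    have h2 := constTerm_of_mem_kerBSub 0 c ((mem_kerB 0 c 1).mp h1)
    rw [map_one] at h2
    exact one_ne_zero h2
  · obtain ⟨hle, q, hqM, hq⟩ := SetLike.lt_iff_le_and_exists.mp hM
    obtain ⟨f, rfl⟩ := mk_surj q
    -- `D` bounds the degrees in which `f` can fail the line conditions. A Dunkl derivative lowers
    -- it by one, so `f` need not be homogeneous.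
    have key : ∀ D, ∀ f : MvPolynomial (Fin n) k, Ideal.Quotient.mk (sumIdeal k n) f ∈ M →
        Ideal.Quotient.mk (sumIdeal k n) f ∉ kerB n 0 c →
        (∀ d, D ≤ d → lineCoeff d f ∈ lineRadical k n p d) → M = ⊤ := by
      intro D
      induction D with
      | zero =>
        intro f _ hf h
        exact absurd ((mem_kerB 0 c _).mpr
          ((mk_mem_kerBSub_iff hn3 hn hc f).mpr fun d => h d d.zero_le)) hf
      | succ D ih =>
        intro f hfM hf h
        -- If every derivative is in the kernel, then so is `f` minus its constant term. That
        -- constant is therefore nonzero and belongs to `M`.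
        by_cases hD : ∀ i j, dunkl 0 c (yDiff k n i j) (Ideal.Quotient.mk (sumIdeal k n) f)
            ∈ kerB n 0 c
        · set q := Ideal.Quotient.mk (sumIdeal k n) f
          have hker : q - algebraMap k _ (constTerm q) ∈ kerB n 0 c := by
            rw [mem_kerB]
            refine mem_kerBSub_of_dunkl_mem (by simp) fun i j => ?_
            have h1 : dunkl 0 c (yDiff k n i j)
                (algebraMap k (SymHDual k n) (constTerm q)) = 0 := by
              change dunkl 0 c (yDiff k n i j) (Ideal.Quotient.mk _ (C (constTerm q))) = 0
              rw [dunkl_yDiff_mk, dunklV_C, dunklV_C, sub_zero, map_zero]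
            rw [map_sub, h1, sub_zero, ← mem_kerB]
            exact hD i j
          have h0 : constTerm q ≠ 0 := by
            intro h0
            rw [h0, map_zero, sub_zero] at hker
            exact hf hker
          have hM1 := M.sub_mem hfM (hle hker)
          rw [sub_sub_cancel] at hM1
          have hM2 := algebraMap_mul_mem M (constTerm q)⁻¹ hM1
          rw [← map_mul, inv_mul_cancel₀ h0, map_one] at hM2
          exact eq_top_of_one_mem M hM2
        · push Not at hD
          obtain ⟨i, j, hij⟩ := hD
          have hM1 := dunkl_mem M (yDiff k n i j) hfM
          rw [dunkl_yDiff_mk] at hij hM1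
          refine ih _ hM1 hij fun d hd => ?_
          rw [map_sub, lineCoeff_dunklV hn, lineCoeff_dunklV hn]
          have h1 := (mem_lineRadical_succ hn3 hn hc d _).mp (h (d + 1) (by omega))
          exact Submodule.sub_mem _ (h1 i) (h1 j)
    -- From degree `p + 2` on the line conditions are void, so this bound works for every
    -- polynomial.
    refine key (p + 2) f hqM hq fun d hd => ?_
    rw [lineRadical_of_le hd]
    trivial

end Kernel

/-! ### The grading of the quotient and its dimensions -/

section Grading

variable {k : Type*} [Field k] {n : ℕ}

variable (n) in
/-- The projection of `k[x_1, …, x_n]` onto `L_{t,c}`. -/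
noncomputable def irredProj (t c : k) : MvPolynomial (Fin n) k →ₗ[k] IrredQuot n t c :=
  (kerB n t c).mkQ.restrictScalars k ∘ₗ (Ideal.Quotient.mkₐ k (sumIdeal k n)).toLinearMap

theorem gradedPiece_eq_map (t c : k) : gradedPiece n t c =
    fun d => (homogeneousSubmodule (Fin n) k d).map (irredProj n t c) := rfl

theorem irredProj_surjective (t c : k) : Function.Surjective (irredProj n t c) :=
  (kerB n t c).mkQ_surjective.comp mk_surj

theorem irredProj_eq_zero_iff {p : ℕ} [Fact p.Prime] [CharP k p] (hn3 : 3 ≤ n) (hn : (n : k) = 1)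
    {c : k} (hc : c ≠ 0) (f : MvPolynomial (Fin n) k) :
    irredProj n 0 c f = 0 ↔ ∀ d, lineCoeff d f ∈ lineRadical k n p d := by
  rw [← mk_mem_kerBSub_iff hn3 hn hc, ← mem_kerB]
  exact Submodule.Quotient.mk_eq_zero _

theorem irredProj_eq_zero_iff_of_isHomogeneous {p : ℕ} [Fact p.Prime] [CharP k p] (hn3 : 3 ≤ n)
    (hn : (n : k) = 1) {c : k} (hc : c ≠ 0) {d : ℕ} {f : MvPolynomial (Fin n) k}
    (hf : f.IsHomogeneous d) :
    irredProj n 0 c f = 0 ↔ lineCoeff d f ∈ lineRadical k n p d := by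
  rw [irredProj_eq_zero_iff (p := p) hn3 hn hc]
  refine ⟨fun h => h d, fun h e => ?_⟩
  rcases eq_or_ne e d with rfl | he
  · exact h
  · rw [lineCoeff_homogeneous he hf]
    exact Submodule.zero_mem _

theorem isInternal_gradedPiece {p : ℕ} [Fact p.Prime] [CharP k p] (hn3 : 3 ≤ n)
    (hn : (n : k) = 1) {c : k} (hc : c ≠ 0) : DirectSum.IsInternal (gradedPiece n 0 c) := by
  rw [DirectSum.isInternal_submodule_iff_iSupIndep_and_iSup_eq_top, gradedPiece_eq_map]
  constructor
  · intro d
    rw [Submodule.disjoint_def]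
    rintro _ ⟨f, hf, rfl⟩ hx
    simp only [← Submodule.map_iSup] at hx
    obtain ⟨g, hg, hgf⟩ := hx
    -- Independence rests on this: degree `d` line values ignore all other degrees, so the part `g`
    -- from other degrees contributes nothing to the condition on `f`.
    have hle : ⨆ e, ⨆ (_ : e ≠ d), homogeneousSubmodule (Fin n) k e
        ≤ LinearMap.ker (lineCoeff d : MvPolynomial (Fin n) k →ₗ[k] _) :=
      iSup₂_le fun e he g hg => lineCoeff_homogeneous (Ne.symm he) hg
    have hg0 : lineCoeff d g = 0 := hle hg
    have h0 : irredProj n 0 c (g - f) = 0 := by rw [map_sub, hgf, sub_self]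
    have h1 := (irredProj_eq_zero_iff (p := p) hn3 hn hc _).mp h0 d
    rw [map_sub, hg0, zero_sub, Submodule.neg_mem_iff] at h1
    exact (irredProj_eq_zero_iff_of_isHomogeneous hn3 hn hc hf).mpr h1
  · rw [← Submodule.map_iSup, eq_top_iff]
    rintro x -
    obtain ⟨f, rfl⟩ := irredProj_surjective 0 c x
    refine Submodule.mem_map_of_mem ?_
    rw [← sum_homogeneousComponent f]
    exact Submodule.sum_mem _ fun d _ =>
      Submodule.mem_iSup_of_mem d (homogeneousComponent_isHomogeneous d f)

/-- Both spaces are images of the homogeneous polynomials of degree `d` under maps with the same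
kernel. -/
theorem finrank_gradedPiece {p : ℕ} [Fact p.Prime] [CharP k p] (hn3 : 3 ≤ n)
    (hn : (n : k) = 1) {c : k} (hc : c ≠ 0) (d : ℕ) :
    Module.finrank k (gradedPiece n 0 c d)
      = Module.finrank k ((lineRange k n d).map (lineRadical k n p d).mkQ) := by
  let φ := (irredProj n 0 c).domRestrict (homogeneousSubmodule (Fin n) k d)
  let ψ := ((lineRadical k n p d).mkQ ∘ₗ lineCoeff d).domRestrict
    (homogeneousSubmodule (Fin n) k d)
  have hker : LinearMap.ker φ = LinearMap.ker ψ := by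
    ext f
    rw [LinearMap.mem_ker, LinearMap.mem_ker, LinearMap.domRestrict_apply,
      LinearMap.domRestrict_apply, LinearMap.comp_apply, Submodule.mkQ_apply,
      Submodule.Quotient.mk_eq_zero, irredProj_eq_zero_iff_of_isHomogeneous hn3 hn hc f.2]
  have hφ : LinearMap.range φ = gradedPiece n 0 c d := LinearMap.range_domRestrict _ _
  have hψ : LinearMap.range ψ = (lineRange k n d).map (lineRadical k n p d).mkQ := by
    rw [lineRange, ← Submodule.map_comp]
    exact LinearMap.range_domRestrict _ _
  rw [← hφ, ← hψ]
  exact (φ.quotKerEquivRange.symm ≪≫ₗ Submodule.quotEquivOfEq _ _ hker ≪≫ₗ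
    ψ.quotKerEquivRange).finrank_eq

end Grading

/-! ### Comparison of power series -/

section Series

theorem zInt_eq_mk (m : ℕ) : zInt m = PowerSeries.mk fun d => if d < m then 1 else 0 := by
  have h0 : PowerSeries.constantCoeff (1 - PowerSeries.X : PowerSeries ℚ) ≠ 0 := by simp
  rw [zInt, eq_comm, PowerSeries.eq_mul_inv_iff_mul_eq h0]
  ext d
  rw [mul_sub, mul_one]
  cases d with
  | zero =>
    simp only [map_sub, PowerSeries.coeff_mk, PowerSeries.coeff_zero_mul_X, PowerSeries.coeff_one,
      PowerSeries.coeff_X_pow]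
    rcases Nat.eq_zero_or_pos m with rfl | hm
    · simp
    · simp [hm, hm.ne]
  | succ d =>
    simp only [map_sub, PowerSeries.coeff_mk, PowerSeries.coeff_succ_mul_X, PowerSeries.coeff_one,
      PowerSeries.coeff_X_pow]
    rcases lt_trichotomy (d + 1) m with h | h | h
    · simp [h, h.ne, show d < m by omega]
    · simp [h, show d < m by omega, show m ≠ 0 by omega]
    · simp [h.ne', show ¬ d < m by omega, show ¬ d + 1 < m by omega]

theorem hilbertSeries_eq {k : Type*} [Field k] {n p : ℕ} [Fact p.Prime] [CharP k p] (hn3 : 3 ≤ n)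
    (hn : (n : k) = 1) {c : k} (hc : c ≠ 0) :
    hilbertSeries n 0 c
      = zInt p * (1 + ((n : PowerSeries ℚ) - 2) * PowerSeries.X + PowerSeries.X ^ 2) := by
  have hC : (n : PowerSeries ℚ) - 2 = PowerSeries.C ((n : ℚ) - 2) := by
    rw [map_sub, map_natCast, map_ofNat]
  ext d
  have h := finrank_map_mkQ_lineRange (k := k) (Fact.out : p.Prime).two_le (n := n) (by omega) hn d
  rw [← finrank_gradedPiece (p := p) hn3 hn hc] at h
  have hq := congrArg (fun z : ℤ => (z : ℚ)) h
  push_cast at hq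
  rw [hilbertSeries, PowerSeries.coeff_mk, hq, zInt_eq_mk, hC, mul_add, mul_add, mul_one,
    mul_left_comm, map_add, map_add, PowerSeries.coeff_C_mul, PowerSeries.coeff_mk,
    PowerSeries.coeff_mul_X_pow']
  congr 1
  · congr 2
    cases d <;> simp [PowerSeries.coeff_zero_mul_X, PowerSeries.coeff_succ_mul_X]
  · rw [PowerSeries.coeff_mk, ite_and]

/-- For `r = 1` the factorial is `1`, the leading binomial term is `z^2`, and the sum contributes `1
+ (n-2) z`. -/
theorem etingofRainsSeries_eq {p n : ℕ} (hr : n % p = 1) :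
    etingofRainsSeries p n
      = zInt p * (1 + ((n : PowerSeries ℚ) - 2) * PowerSeries.X + PowerSeries.X ^ 2) := by
  have h1 : zInt 1 = 1 := by
    rw [zInt_eq_mk]
    ext d
    simp [PowerSeries.coeff_one]
  rw [etingofRainsSeries, hr, zFactorial, etingofRainsQ]
  simp only [Finset.Icc_self, Finset.prod_singleton, h1, one_mul, one_ne_zero, if_false,
    Nat.sub_self, Nat.choose_zero_right, Nat.cast_one, Finset.sum_range_succ, Finset.sum_range_zero,
    Nat.cast_zero, Ring.choose_zero_right, Ring.choose_one_right, pow_zero, pow_one]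
  push_cast
  ring

end Series

end RationalCherednik

theorem theorem2p34 {k : Type*} [Field k] (p : ℕ) [Fact p.Prime] [CharP k p]
    (n : ℕ) (hn : 1 < n) (hpn : p ∣ n - 1) (c : k) (hc : c ≠ 0) :
    IsSimpleModule (RationalCherednik.CherednikAlgebra k n 0 c)
        (RationalCherednik.IrredQuot n 0 c) ∧
      DirectSum.IsInternal (RationalCherednik.gradedPiece n 0 c) ∧
      RationalCherednik.hilbertSeries n 0 c =
        (1 - PowerSeries.X ^ p) * (1 - PowerSeries.X)⁻¹ *
          (1 + ((n : PowerSeries ℚ) - 2) * PowerSeries.X + PowerSeries.X ^ 2) ∧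
      RationalCherednik.hilbertSeries n 0 c = RationalCherednik.etingofRainsSeries p n := by
  have hp2 := (Fact.out : p.Prime).two_le
  have hle := Nat.le_of_dvd (by omega) hpn
  obtain ⟨a, ha⟩ := hpn
  obtain rfl : n = p * a + 1 := by omega
  have hnk : ((p * a + 1 : ℕ) : k) = 1 := by
    push_cast
    rw [CharP.cast_eq_zero k p, zero_mul, zero_add]
  have hr : (p * a + 1) % p = 1 := by
    rw [Nat.mul_add_mod, Nat.mod_eq_of_lt (by omega)]
  -- Divisibility gives `n ≥ p + 1`, and `p ≥ 2`.
  have hn3 : 3 ≤ p * a + 1 := by omega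
  have hH := RationalCherednik.hilbertSeries_eq (p := p) hn3 hnk hc
  exact ⟨RationalCherednik.isSimpleModule_irredQuot (p := p) hn3 hnk hc,
    RationalCherednik.isInternal_gradedPiece (p := p) hn3 hnk hc, hH,
    hH.trans (RationalCherednik.etingofRainsSeries_eq hr).symm⟩
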